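/- **Proposition 2.1.** Let $\varepsilon>0$, $q=e^{-\varepsilon}$, and let $s_t=(s_t(x))_{x\in\mathbb Z}$, $t\ge 0$, be the dynamic ASEP with $\alpha=1$: the càdlàg process with state space $\mathcal S=\{s:\mathbb Z\to\mathbb R:\ |s(x+1)-s(x)|=1\ \forall x\in\mathbb Z\}$ and generator $$(\mathcal L f)(s)=\sum_{x\in\mathbb Z}\Big[\mathbf 1_{\{s(x)>s(x\pm1)\}}\,\tfrac{q(1+q^{-s(x)})}{1+q^{-s(x)+1}}\big(f(s^{x,-2})-f(s)\big)+\mathbf 1_{\{s(x)<s(x\pm1)\}}\,\tfrac{1+q^{-s(x)}}{1+q^{-s(x)-1}}\big(f(s^{x,+2})-f(s)\big)\Big],$$ where $s^{x,\pm2}$ is $s$ with $s(x)$ replaced by $s(x)\pm2$ (that is, for each bounded measurable $f$ depending on finitely many heights, $f(s_t)-\int_0^t\mathcal Lf(s_r)\,dr$ is a martingale for the natural filtration of $s$); the initial state $s_0$ may be random. Put $\theta_1=(1-\sqrt q)^2$, $\theta_2=2\sqrt q$, $$Z_t(x)=e^{\theta_1t}\big(q^{-s_t(x)/2}-q^{s_t(x)/2}\big),\qquad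 M_t(x)=Z_t(x)-\int_0^t\big(\mathcal LZ_r(x)+\theta_1Z_r(x)\big)\,dr ,$$ where $\mathcal L$ acts on $s_r$ in $Z_r(x)$. Write $\nabla^{\pm}f(x)=\pm(f(x\pm1)-f(x))$ and $\Delta=\nabla^+-\nabla^-$. Then $Z$ satisfies the microscopic stochastic heat equation $$dZ_t(x)=\tfrac{\theta_2}{2}\Delta Z_t(x)\,dt+dM_t(x),\qquad x\in\mathbb Z,$$ i.e. $Z_t(x)=Z_0(x)+\int_0^t\tfrac{\theta_2}{2}\Delta Z_r(x)\,dr+M_t(x)-M_0(x)$. If $Z_0(x)$ is integrable for every $x$, then each $M(x)$ is a martingale with respect to the natural filtration of $s$. If $Z_0(x)$ is square integrable for every $x$, then the predictable quadratic covariations of these martingales are absolutely continuous in $t$, and they satisfy the following, where $\frac{d}{dt}$ is the right derivative, which exists at every $t\ge0$. 1. For all $x,y\in\mathbb Z$ and $t\ge 0$, $$\frac{d}{dt}\langle M(y),M(x)\rangle_t=\mathbf 1_{\{x=y\}}\,\frac{\varepsilon^2e^{2t\theta_1}}{2}\,q^{-1}\big(1+q^{-s_t(x)}\big)\big(q^{\frac{s_t(x+1)+s_t(x-1)}2}+1\big)\big(1-\nabla^+s_t(x)\nabla^-s_t(x)+\mathcal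 E^\varepsilon_t(x)\big),$$ where $|\mathcal E^\varepsilon_t(x)|\le C\varepsilon$ for all $t$ and $x$, with a universal constant $C$ (independent of $\varepsilon$, $t$, $x$ and of the process). 2. If $\varepsilon\le1$, then for all $x\in\mathbb Z$ and $t\ge0$, $$\frac{d}{dt}\langle M(x),M(x)\rangle_t\le 2\varepsilon^2\big(Z_t(x)^2+2e^{2t\theta_1}\big).$$ -/

import Mathlib

open MeasureTheory Filter Topology
open scoped NNReal

noncomputable section

namespace DynASEP

/-- The state space: height functions on `ℤ` with unit slopes. (Heights are real numbers, since after
the shift that normalises the dynamic parameter to `1` they live on a shift of `ℤ`.) -/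
def stateSpace : Set (ℤ → ℝ) := {s | ∀ x, |s (x + 1) - s x| = 1}

/-- Rate of the downward jump `u ↦ u - 2` of a height `u`. -/
def rateDown (q u : ℝ) : ℝ := q * (1 + q ^ (-u)) / (1 + q ^ (-u + 1))

/-- Rate of the upward jump `u ↦ u + 2` of a height `u`. -/
def rateUp (q u : ℝ) : ℝ := (1 + q ^ (-u)) / (1 + q ^ (-u - 1))

open Classical in
/-- Indicator that `x` is a local maximum of `s`, so that `s x` may jump down. -/
def etaDown (s : ℤ → ℝ) (x : ℤ) : ℝ := if s (x - 1) < s x ∧ s (x + 1) < s x then 1 else 0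

open Classical in
/-- Indicator that `x` is a local minimum of `s`, so that `s x` may jump up. -/
def etaUp (s : ℤ → ℝ) (x : ℤ) : ℝ := if s x < s (x - 1) ∧ s x < s (x + 1) then 1 else 0

/-- The height function obtained from `s` by replacing `s x` with `s x + h`. -/
def shiftAt (s : ℤ → ℝ) (x : ℤ) (h : ℝ) : ℤ → ℝ := Function.update s x (s x + h)

/-- The generator of the dynamic ASEP. It is applied to functions of finitely many heights only,
for which all but finitely many terms of the sum vanish. -/
def generator (q : ℝ) (f : (ℤ → ℝ) → ℝ) (s : ℤ → ℝ) : ℝ :=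
  ∑' x : ℤ, (etaDown s x * rateDown q (s x) * (f (shiftAt s x (-2)) - f s)
    + etaUp s x * rateUp q (s x) * (f (shiftAt s x 2) - f s))

/-- `f` is a bounded measurable local function: it depends on finitely many heights. -/
structure IsTestFunction (f : (ℤ → ℝ) → ℝ) : Prop where
  measurable : Measurable f
  bounded : ∃ K : ℝ, ∀ s, |f s| ≤ K
  local_dep : ∃ J : Finset ℤ, DependsOn f (J : Set ℤ)

variable {Ω : Type*} [MeasurableSpace Ω]

/-- `s` is a dynamic ASEP with parameters `q` and `α = 1` (and an arbitrary, possibly random, initial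
state): a càdlàg process with values in the state space that solves the martingale problem for the
generator on bounded local functions, with respect to its natural filtration. -/
structure IsDynamicASEP (q : ℝ) (P : Measure Ω) (s : ℝ≥0 → Ω → ℤ → ℝ) : Prop where
  stronglyMeasurable : ∀ t, StronglyMeasurable (s t)
  mem_stateSpace : ∀ t ω, s t ω ∈ stateSpace
  right_continuous : ∀ ω t, ContinuousWithinAt (fun r => s r ω) (Set.Ici t) t
  left_limits : ∀ ω t, ∃ l : ℤ → ℝ, Tendsto (fun r => s r ω) (𝓝[<] t) (𝓝 l)
  martingale_problem : ∀ f, IsTestFunction f →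
    Martingale (fun (t : ℝ≥0) ω => f (s t ω) - ∫ r in (0 : ℝ)..t, generator q f (s r.toNNReal ω))
      (Filtration.natural s stronglyMeasurable) P

/-- The natural filtration of the process. -/
def IsDynamicASEP.filtration {q : ℝ} {P : Measure Ω} {s : ℝ≥0 → Ω → ℤ → ℝ}
    (hs : IsDynamicASEP q P s) : Filtration ℝ≥0 (inferInstance : MeasurableSpace Ω) :=
  Filtration.natural s hs.stronglyMeasurable

/-- The constant `θ₁ = (1 - √q)²`. -/
def theta1 (q : ℝ) : ℝ := (1 - √q) ^ 2

/-- The constant `θ₂ = 2 √q`. -/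
def theta2 (q : ℝ) : ℝ := 2 * √q

/-- The microscopic Hopf-Cole transform, as a function of time, site and height function. -/
def hopfCole (q t : ℝ) (x : ℤ) (s : ℤ → ℝ) : ℝ :=
  Real.exp (theta1 q * t) * (q ^ (-(s x / 2)) - q ^ (s x / 2))

/-- The process `Z_t(x)`. -/
def Z (q : ℝ) (s : ℝ≥0 → Ω → ℤ → ℝ) (t : ℝ≥0) (x : ℤ) (ω : Ω) : ℝ := hopfCole q t x (s t ω)

/-- The drift `ℒ Z_t(x) + θ₁ Z_t(x)`, where the generator acts on `s_t` in `Z_t(x)`. -/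
def drift (q : ℝ) (s : ℝ≥0 → Ω → ℤ → ℝ) (t : ℝ≥0) (x : ℤ) (ω : Ω) : ℝ :=
  generator q (hopfCole q t x) (s t ω) + theta1 q * Z q s t x ω

/-- The process `M(x)`, that is `M_t(x) = Z_t(x) - ∫₀ᵗ (ℒ Z_r(x) + θ₁ Z_r(x)) dr`. -/
def M (q : ℝ) (s : ℝ≥0 → Ω → ℤ → ℝ) (x : ℤ) (t : ℝ≥0) (ω : Ω) : ℝ :=
  Z q s t x ω - ∫ r in (0 : ℝ)..t, drift q s r.toNNReal x ω

/-- Forward discrete derivative. -/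
def gradPlus (f : ℤ → ℝ) (x : ℤ) : ℝ := f (x + 1) - f x

/-- Backward discrete derivative. -/
def gradMinus (f : ℤ → ℝ) (x : ℤ) : ℝ := -(f (x - 1) - f x)

/-- Nearest-neighbour discrete Laplacian. -/
def laplacian (f : ℤ → ℝ) (x : ℤ) : ℝ := gradPlus f x - gradMinus f x

/-- `A` is the predictable quadratic covariation of `N₁` and `N₂`: a predictable process, null at `0`,
with right-continuous paths of locally bounded variation, such that `N₁ N₂ - A` is a martingale. -/
structure IsPredictableCovariation (ℱ : Filtration ℝ≥0 (inferInstance : MeasurableSpace Ω))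
    (P : Measure Ω) (N₁ N₂ A : ℝ≥0 → Ω → ℝ) : Prop where
  predictable : IsStronglyPredictable ℱ A
  zero : ∀ ω, A 0 ω = 0
  right_continuous : ∀ ω t, ContinuousWithinAt (fun r => A r ω) (Set.Ici t) t
  bounded_variation : ∀ ω, LocallyBoundedVariationOn (fun t => A t ω) Set.univ
  martingale : Martingale (fun t ω => N₁ t ω * N₂ t ω - A t ω) ℱ P

/-- The density of the bracket of `M(y)` and `M(x)` at time `t`, in terms of the height function
`s = s_t` and of the value `e` of the error term at `(t, x)`. -/
def bracketDensity (ε t : ℝ) (y x : ℤ) (s : ℤ → ℝ) (e : ℝ) : ℝ :=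
  if x = y then
    ε ^ 2 * Real.exp (2 * t * theta1 (Real.exp (-ε))) / 2 * (Real.exp (-ε))⁻¹
      * (1 + Real.exp (-ε) ^ (-s x)) * (Real.exp (-ε) ^ ((s (x + 1) + s (x - 1)) / 2) + 1)
      * (1 - gradPlus s x * gradMinus s x + e)
  else 0

end DynASEP

end

/-! The rates are tuned to the Hopf-Cole function `sinhHeight`: the rate of a jump times the
increment of q^(-u/2) - q^(u/2) is -(1-q) or +(1-q) times `coshHeight`, for a jump down or up. On
unit slopes, a check of the four local configurations turns the drift ℒZ + θ₁Z into √q ΔZ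
(`localGenerator_sinhHeight_eq_laplacian`). This is a pathwise identity, and with it the heat
equation is just the definition of M.

The martingale problem covers bounded functions only, whereas Z is unbounded. A jump by ±2
multiplies `coshHeight` by at most 1/q, and each site jumps at total rate at most 1, so the
generator maps the p-th power of `coshHeight` to at most q^(-p) - 1 times itself. Truncation and a
Gronwall argument propagate initial moments to all times (`moment_bound`). Moments of order one and
two dominate the truncations of Z and of products of two Z's, which gives Dynkin's formula for them
(`martingale_of_dominated`). The factors exp(θ₁t) and exp(2θ₁t) are inserted by integration by parts
(`martingale_exp_mul`).

For the bracket, the compensator of Z(y)Z(x) is the carré du champ plus the two drift terms;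
`martingale_mul_sub_bracket` removes the latter. What is left is the integral of a càdlàg density,
hence continuous and predictable, with a right derivative everywhere. One jump changes one height,
so the density vanishes off the diagonal. On the diagonal it is explicit, the error term is chosen
to make the formula exact, and both bounds reduce to estimates of exp(-ε). -/

noncomputable section

namespace DynASEP

/-! ### Càdlàg paths and calculus with their primitives. -/

/-- Real-valued paths that are right-continuous with left limits. -/
structure IsCadlag (g : ℝ≥0 → ℝ) : Prop where
  right : ∀ t, ContinuousWithinAt g (Set.Ici t) t
  left : ∀ t, ∃ l, Tendsto g (𝓝[<] t) (𝓝 l)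

/-- The primitive of a path. -/
def primitive (g : ℝ≥0 → ℝ) (t : ℝ≥0) : ℝ := ∫ r in (0 : ℝ)..t, g r.toNNReal

namespace IsCadlag

variable {f g : ℝ≥0 → ℝ}

theorem of_continuous (h : Continuous g) : IsCadlag g :=
  ⟨fun _ => h.continuousWithinAt, fun t => ⟨g t, h.continuousAt.tendsto.mono_left inf_le_left⟩⟩

theorem const (c : ℝ) : IsCadlag fun _ => c := of_continuous continuous_const

theorem add (hf : IsCadlag f) (hg : IsCadlag g) : IsCadlag fun t => f t + g t :=
  ⟨fun t => (hf.right t).add (hg.right t), fun t => by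
    obtain ⟨a, ha⟩ := hf.left t
    obtain ⟨b, hb⟩ := hg.left t
    exact ⟨_, ha.add hb⟩⟩

theorem sub (hf : IsCadlag f) (hg : IsCadlag g) : IsCadlag fun t => f t - g t :=
  ⟨fun t => (hf.right t).sub (hg.right t), fun t => by
    obtain ⟨a, ha⟩ := hf.left t
    obtain ⟨b, hb⟩ := hg.left t
    exact ⟨_, ha.sub hb⟩⟩

theorem mul (hf : IsCadlag f) (hg : IsCadlag g) : IsCadlag fun t => f t * g t :=
  ⟨fun t => (hf.right t).mul (hg.right t), fun t => by
    obtain ⟨a, ha⟩ := hf.left t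
    obtain ⟨b, hb⟩ := hg.left t
    exact ⟨_, ha.mul hb⟩⟩

/-- The left limit bounds the path just before a time and right continuity bounds it from that time
on, so it is locally bounded; compactness of `[0, T]` does the rest. -/
theorem exists_bound (hg : IsCadlag g) (T : ℝ≥0) : ∃ K, ∀ t ≤ T, |g t| ≤ K := by
  have key : ∃ K, ∀ t ∈ Set.Icc 0 T, |g t| ≤ K := by
    refine isCompact_Icc.induction_on (p := fun s => ∃ K, ∀ t ∈ s, |g t| ≤ K)
      ⟨0, by simp⟩ (fun s t hst ⟨K, hK⟩ => ⟨K, fun r hr => hK r (hst hr)⟩) ?_ ?_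
    · rintro s t ⟨K, hK⟩ ⟨K', hK'⟩
      exact ⟨max K K', fun r hr => hr.elim (fun h => (hK r h).trans (le_max_left _ _))
        fun h => (hK' r h).trans (le_max_right _ _)⟩
    · intro t _
      obtain ⟨l, hl⟩ := hg.left t
      have h1 : ∀ᶠ r in 𝓝[<] t, |g r| ≤ |l| + 1 :=
        (hl.abs.eventually (gt_mem_nhds (lt_add_one _))).mono fun _ h => h.le
      have h2 : ∀ᶠ r in 𝓝[≥] t, |g r| ≤ |g t| + 1 :=
        ((hg.right t).abs.eventually (gt_mem_nhds (lt_add_one _))).mono fun _ h => h.le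
      have h3 : ∀ᶠ r in 𝓝 t, |g r| ≤ max (|l| + 1) (|g t| + 1) := by
        rw [← nhdsLT_sup_nhdsGE, eventually_sup]
        exact ⟨h1.mono fun _ h => h.trans (le_max_left _ _),
          h2.mono fun _ h => h.trans (le_max_right _ _)⟩
      exact ⟨_, mem_nhdsWithin_of_mem_nhds h3, _, fun r hr => hr⟩
  obtain ⟨K, hK⟩ := key
  exact ⟨K, fun t ht => hK t ⟨zero_le, ht⟩⟩

end IsCadlag

/-! ### Joint measurability of right-continuous processes. -/

/-- The next point after `r` of the grid of mesh `(n + 1)⁻¹`. -/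
def gridAfter (n : ℕ) (r : ℝ≥0) : ℝ≥0 := (⌊r * (n + 1)⌋₊ + 1) / (n + 1)

theorem lt_gridAfter (n : ℕ) (r : ℝ≥0) : r < gridAfter n r := by
  rw [gridAfter, lt_div_iff₀ (by positivity)]
  exact Nat.lt_floor_add_one _

theorem gridAfter_le (n : ℕ) (r : ℝ≥0) : gridAfter n r ≤ r + 1 / (n + 1) := by
  rw [gridAfter, add_div]
  gcongr
  rw [div_le_iff₀ (by positivity)]
  exact Nat.floor_le (by positivity)

theorem tendsto_gridAfter (r : ℝ≥0) :
    Tendsto (fun n => gridAfter n r) atTop (𝓝[≥] r) := by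
  refine tendsto_nhdsWithin_iff.2 ⟨?_, Eventually.of_forall fun n => (lt_gridAfter n r).le⟩
  have h : Tendsto (fun n : ℕ => r + 1 / ((n : ℝ≥0) + 1)) atTop (𝓝 (r + 0)) :=
    tendsto_const_nhds.add tendsto_one_div_add_atTop_nhds_zero_nat
  rw [add_zero] at h
  exact tendsto_of_tendsto_of_tendsto_of_le_of_le tendsto_const_nhds h
    (fun n => (lt_gridAfter n r).le) fun n => gridAfter_le n r

/-- Rounding time up to a grid approximates from the right, which suits right-continuous paths.
Stopping at `T` ensures that only variables up to time `T` enter, so the lemma also applies with the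
σ-algebra of time `T` and then yields adaptedness of primitives. -/
theorem measurable_stopped {Ω : Type*} [MeasurableSpace Ω] {X : ℝ≥0 → Ω → ℝ} {T : ℝ≥0}
    (hX : ∀ t ≤ T, Measurable (X t))
    (hc : ∀ ω t, ContinuousWithinAt (fun r => X r ω) (Set.Ici t) t) :
    Measurable fun p : ℝ × Ω => X (min p.1.toNNReal T) p.2 := by
  have hmeas : ∀ n, Measurable fun p : ℝ × Ω => X (min (gridAfter n p.1.toNNReal) T) p.2 := by
    intro n
    have h1 : Measurable fun p : ℕ × Ω => X (min (((p.1 : ℝ≥0) + 1) / (n + 1)) T) p.2 :=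
      measurable_from_prod_countable_right
        fun k => hX (min (((k : ℝ≥0) + 1) / (n + 1)) T) (min_le_right _ _)
    have h2 : Measurable fun p : ℝ × Ω => (⌊p.1.toNNReal * (n + 1)⌋₊, p.2) :=
      (Nat.measurable_floor.comp
        ((measurable_real_toNNReal.comp measurable_fst).mul_const _)).prodMk measurable_snd
    have h3 := h1.comp h2
    simp only [Function.comp_def] at h3
    simpa only [gridAfter] using h3
  refine measurable_of_tendsto_metrizable hmeas (tendsto_pi_nhds.2 fun p => ?_)
  have h3 : Tendsto (fun n => min (gridAfter n p.1.toNNReal) T) atTop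
      (𝓝[≥] (min p.1.toNNReal T)) := by
    refine tendsto_nhdsWithin_iff.2 ⟨?_, Eventually.of_forall fun n => ?_⟩
    · exact ((tendsto_gridAfter _).mono_right inf_le_left).min tendsto_const_nhds
    · exact min_le_min_right _ (lt_gridAfter n _).le
  exact (hc p.2 _).tendsto.comp h3

theorem measurable_uncurry_toNNReal {Ω : Type*} [MeasurableSpace Ω] {X : ℝ≥0 → Ω → ℝ}
    (hX : ∀ t, Measurable (X t))
    (hc : ∀ ω t, ContinuousWithinAt (fun r => X r ω) (Set.Ici t) t) :
    Measurable fun p : ℝ × Ω => X p.1.toNNReal p.2 := by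
  refine measurable_of_tendsto_metrizable (f := fun (n : ℕ) (p : ℝ × Ω) =>
    X (min p.1.toNNReal n) p.2) (fun n => measurable_stopped (fun t _ => hX t) hc)
    (tendsto_pi_nhds.2 fun p => ?_)
  obtain ⟨N, hN⟩ := exists_nat_ge p.1.toNNReal
  refine tendsto_const_nhds.congr' ((eventually_ge_atTop N).mono fun n hn => ?_)
  have : p.1.toNNReal ≤ n := hN.trans (by exact_mod_cast hn)
  simp [min_eq_left this]

namespace IsCadlag

variable {f g : ℝ≥0 → ℝ}

theorem measurable_toNNReal (hg : IsCadlag g) : Measurable fun r : ℝ => g r.toNNReal :=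
  (measurable_uncurry_toNNReal (Ω := Unit) (X := fun t _ => g t) (fun _ => measurable_const)
    fun _ => hg.right).comp (measurable_id.prodMk (measurable_const (a := ())))

theorem intervalIntegrable (hg : IsCadlag g) (a b : ℝ) :
    IntervalIntegrable (fun r : ℝ => g r.toNNReal) volume a b := by
  obtain ⟨K, hK⟩ := hg.exists_bound (max a b).toNNReal
  refine (intervalIntegrable_const (c := K)).mono_fun'
    hg.measurable_toNNReal.aestronglyMeasurable ?_
  refine (ae_restrict_mem measurableSet_uIoc).mono fun r hr => ?_
  exact hK _ (Real.toNNReal_le_toNNReal hr.2)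

theorem continuous_primitive (hg : IsCadlag g) : Continuous (primitive g) :=
  (intervalIntegral.continuous_primitive (fun a b => hg.intervalIntegrable a b) 0).comp
    NNReal.continuous_coe

theorem primitive (hg : IsCadlag g) : IsCadlag (primitive g) :=
  of_continuous hg.continuous_primitive

theorem right_toNNReal (hg : IsCadlag g) (t : ℝ) :
    ContinuousWithinAt (fun r : ℝ => g r.toNNReal) (Set.Ici t) t :=
  (hg.right t.toNNReal).comp continuous_real_toNNReal.continuousWithinAt
    fun _ hr => Real.toNNReal_le_toNNReal hr

theorem hasDerivWithinAt_primitive (hg : IsCadlag g) (t : ℝ) :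
    HasDerivWithinAt (fun u : ℝ => ∫ r in (0 : ℝ)..u, g r.toNNReal) (g t.toNNReal)
      (Set.Ici t) t :=
  intervalIntegral.integral_hasDerivWithinAt_right (hg.intervalIntegrable _ _)
    ⟨Set.univ, univ_mem, hg.measurable_toNNReal.aestronglyMeasurable⟩
    ((hg.right_toNNReal t).mono Set.Ioi_subset_Ici_self)

/-- If `F` is continuous with càdlàg right derivative `f`, then `F` is the integral of `f`. -/
theorem integral_eq_sub (hf : IsCadlag f) {F : ℝ → ℝ} (hF : Continuous F)
    (hd : ∀ t, 0 ≤ t → HasDerivWithinAt F (f t.toNNReal) (Set.Ici t) t) (t : ℝ≥0) :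
    DynASEP.primitive f t = F t - F 0 :=
  intervalIntegral.integral_eq_sub_of_hasDeriv_right_of_le t.2 hF.continuousOn
    (fun r hr => (hd r hr.1.le).mono Set.Ioi_subset_Ici_self) (hf.intervalIntegrable _ _)

theorem continuous_integral (hg : IsCadlag g) :
    Continuous fun u : ℝ => ∫ r in (0 : ℝ)..u, g r.toNNReal :=
  intervalIntegral.continuous_primitive (fun a b => hg.intervalIntegrable a b) 0

/-- The product of the primitives is continuous, and its right derivative is given by the product
rule. Two-sided derivatives may fail to exist at jump times, but right derivatives suffice. -/
theorem primitive_mul_primitive (hf : IsCadlag f) (hg : IsCadlag g) (t : ℝ≥0) :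
    DynASEP.primitive f t * DynASEP.primitive g t
      = DynASEP.primitive (fun r => f r * DynASEP.primitive g r) t
        + DynASEP.primitive (fun r => DynASEP.primitive f r * g r) t := by
  have h := (((hf.mul hg.primitive).add (hf.primitive.mul hg))).integral_eq_sub
    (F := fun u => (∫ r in (0 : ℝ)..u, f r.toNNReal) * ∫ r in (0 : ℝ)..u, g r.toNNReal)
    (hf.continuous_integral.mul hg.continuous_integral) (fun t ht => by
      refine ((hf.hasDerivWithinAt_primitive t).mul
        (hg.hasDerivWithinAt_primitive t)).congr_deriv ?_
      simp [DynASEP.primitive, Real.coe_toNNReal t ht]) t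
  simp only [intervalIntegral.integral_same, mul_zero, sub_zero] at h
  rw [DynASEP.primitive, DynASEP.primitive, ← h, DynASEP.primitive]
  exact intervalIntegral.integral_add ((hf.mul hg.primitive).intervalIntegrable _ _)
    ((hf.primitive.mul hg).intervalIntegrable _ _)

theorem primitive_add (hf : IsCadlag f) (hg : IsCadlag g) (t : ℝ≥0) :
    DynASEP.primitive (fun r => f r + g r) t = DynASEP.primitive f t + DynASEP.primitive g t :=
  intervalIntegral.integral_add (hf.intervalIntegrable _ _) (hg.intervalIntegrable _ _)

theorem primitive_const_mul (c : ℝ) (t : ℝ≥0) :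
    DynASEP.primitive (fun r => c * g r) t = c * DynASEP.primitive g t :=
  intervalIntegral.integral_const_mul _ _

theorem primitive_mono (hf : IsCadlag f) (hg : IsCadlag g) (h : ∀ r, f r ≤ g r) (t : ℝ≥0) :
    DynASEP.primitive f t ≤ DynASEP.primitive g t :=
  intervalIntegral.integral_mono_on t.2 (hf.intervalIntegrable _ _) (hg.intervalIntegrable _ _)
    fun _ _ => h _

end IsCadlag

/-! ### Adapted càdlàg processes and predictability. -/

section Adapted

variable {Ω : Type*} [mΩ : MeasurableSpace Ω]

/-- Adapted real-valued processes with càdlàg paths. -/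
structure IsCadlagAdapted (ℱ : Filtration ℝ≥0 mΩ) (X : ℝ≥0 → Ω → ℝ) : Prop where
  adapted : ∀ t, Measurable[ℱ t] (X t)
  cadlag : ∀ ω, IsCadlag fun t => X t ω

theorem measurable_primitive_of_le {Ω : Type*} [MeasurableSpace Ω] {X : ℝ≥0 → Ω → ℝ} {T : ℝ≥0}
    (hX : ∀ t ≤ T, Measurable (X t)) (hc : ∀ ω, IsCadlag fun t => X t ω) :
    Measurable fun ω => primitive (fun r => X r ω) T := by
  have h := (measurable_stopped hX fun ω => (hc ω).right).stronglyMeasurable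
  have h2 : StronglyMeasurable fun ω : Ω =>
      ∫ r : ℝ, X (min r.toNNReal T) ω ∂(volume.restrict (Set.Ioc (0 : ℝ) T)) :=
    h.integral_prod_left'
  convert h2.measurable using 2 with ω
  rw [primitive, intervalIntegral.integral_of_le (NNReal.coe_nonneg T)]
  refine setIntegral_congr_fun measurableSet_Ioc fun r hr => ?_
  have : r.toNNReal ≤ T := Real.toNNReal_le_iff_le_coe.2 hr.2
  simp [min_eq_left this]

namespace IsCadlagAdapted

variable {ℱ : Filtration ℝ≥0 mΩ} {X Y : ℝ≥0 → Ω → ℝ}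

theorem of_continuous {g : ℝ≥0 → ℝ} (hg : Continuous g) : IsCadlagAdapted ℱ fun t _ => g t :=
  ⟨fun _ => measurable_const, fun _ => .of_continuous hg⟩

theorem sub (hX : IsCadlagAdapted ℱ X) (hY : IsCadlagAdapted ℱ Y) :
    IsCadlagAdapted ℱ fun t ω => X t ω - Y t ω :=
  ⟨fun t => (hX.adapted t).sub (hY.adapted t), fun ω => (hX.cadlag ω).sub (hY.cadlag ω)⟩

theorem mul (hX : IsCadlagAdapted ℱ X) (hY : IsCadlagAdapted ℱ Y) :
    IsCadlagAdapted ℱ fun t ω => X t ω * Y t ω :=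
  ⟨fun t => (hX.adapted t).mul (hY.adapted t), fun ω => (hX.cadlag ω).mul (hY.cadlag ω)⟩

theorem primitive (hX : IsCadlagAdapted ℱ X) :
    IsCadlagAdapted ℱ fun t ω => primitive (fun r => X r ω) t :=
  ⟨fun t => @measurable_primitive_of_le Ω (ℱ t) X t
    (fun r hr => (hX.adapted r).mono (ℱ.mono hr) le_rfl) hX.cadlag,
    fun ω => (hX.cadlag ω).primitive⟩

theorem measurable (hX : IsCadlagAdapted ℱ X) (t : ℝ≥0) : Measurable (X t) :=
  (hX.adapted t).mono (ℱ.le t) le_rfl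

theorem measurable_uncurry (hX : IsCadlagAdapted ℱ X) :
    Measurable fun p : ℝ × Ω => X p.1.toNNReal p.2 :=
  measurable_uncurry_toNNReal hX.measurable fun ω => (hX.cadlag ω).right

end IsCadlagAdapted

/-- The last point strictly before `t > 0` of the grid of mesh `(n + 1)⁻¹` (and `0` if `t = 0`). -/
def gridBefore (n : ℕ) (t : ℝ≥0) : ℝ≥0 := ((⌈t * (n + 1)⌉₊ - 1 : ℕ) : ℝ≥0) / (n + 1)

theorem gridBefore_le (n : ℕ) (t : ℝ≥0) : gridBefore n t ≤ t := by
  rw [gridBefore, div_le_iff₀ (by positivity)]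
  rcases Nat.eq_zero_or_pos ⌈t * (n + 1)⌉₊ with h | h
  · simp [h]
  · exact (Nat.lt_ceil.1 (Nat.sub_lt h one_pos)).le

theorem le_gridBefore_add (n : ℕ) (t : ℝ≥0) : t ≤ gridBefore n t + 1 / (n + 1) := by
  rw [gridBefore, ← add_div, le_div_iff₀ (by positivity)]
  refine (Nat.le_ceil _).trans ?_
  exact_mod_cast Nat.le_add_of_sub_le le_rfl

theorem tendsto_gridBefore (t : ℝ≥0) : Tendsto (fun n => gridBefore n t) atTop (𝓝 t) := by
  have h : Tendsto (fun n : ℕ => t - 1 / ((n : ℝ≥0) + 1)) atTop (𝓝 (t - 0)) :=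
    tendsto_const_nhds.sub tendsto_one_div_add_atTop_nhds_zero_nat
  rw [tsub_zero] at h
  exact tendsto_of_tendsto_of_tendsto_of_le_of_le h tendsto_const_nhds
    (fun n => tsub_le_iff_right.2 (le_gridBefore_add n t)) fun n => gridBefore_le n t

/-- Adapted processes with continuous paths are predictable. -/
theorem isStronglyPredictable_of_continuous {ℱ : Filtration ℝ≥0 mΩ} {X : ℝ≥0 → Ω → ℝ}
    (hX : ∀ t, Measurable[ℱ t] (X t)) (hc : ∀ ω, Continuous fun t => X t ω) :
    IsStronglyPredictable ℱ X := by
  -- Rounding time down to a grid point strictly before it gives a process that is constant on each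
  -- interval (k/(n+1), (k+1)/(n+1)] and measurable at its left end: its level sets are countable
  -- unions of predictable rectangles, plus a piece at time `0`.
  have key : ∀ n, Measurable[ℱ.predictable]
      fun p : ℝ≥0 × Ω => X (gridBefore n p.1) p.2 := by
    intro n B hB
    have hset : (fun p : ℝ≥0 × Ω => X (gridBefore n p.1) p.2) ⁻¹' B
        = ({⊥} ×ˢ (X 0 ⁻¹' B)) ∪ ⋃ k : ℕ,
          Set.Ioc ((k : ℝ≥0) / (n + 1)) ((k + 1 : ℕ) / (n + 1)) ×ˢ (X (k / (n + 1)) ⁻¹' B) := by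
      have hn : (0 : ℝ≥0) < n + 1 := by positivity
      ext ⟨t, ω⟩
      simp only [Set.mem_preimage, Set.mem_union, Set.mem_prod, Set.mem_singleton_iff,
        Set.mem_iUnion, Set.mem_Ioc, bot_eq_zero]
      constructor
      · intro h
        rcases eq_or_ne t 0 with rfl | ht
        · left; simpa [gridBefore] using h
        · right
          have hpos : 0 < ⌈t * (n + 1)⌉₊ := Nat.ceil_pos.2 (by positivity)
          refine ⟨⌈t * (n + 1)⌉₊ - 1, ⟨?_, ?_⟩, h⟩
          · rw [div_lt_iff₀ hn]
            exact Nat.lt_ceil.1 (Nat.sub_lt hpos one_pos)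
          · rw [Nat.sub_add_cancel hpos, le_div_iff₀ hn]
            exact Nat.le_ceil _
      · rintro (⟨rfl, h⟩ | ⟨k, ⟨h1, h2⟩, h⟩)
        · simpa [gridBefore] using h
        · have : ⌈t * (n + 1)⌉₊ = k + 1 := by
            rw [Nat.ceil_eq_iff (by simp)]
            exact ⟨by simpa using (div_lt_iff₀ hn).1 h1, (le_div_iff₀ hn).1 h2⟩
          simpa [gridBefore, this] using h
    rw [hset]
    refine MeasurableSet.union (measurableSet_predictable_singleton_bot_prod (hX 0 hB))
      (MeasurableSet.iUnion fun k => measurableSet_predictable_Ioc_prod _ _ (hX _ hB))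
  refine stronglyMeasurable_of_tendsto atTop (fun n => (key n).stronglyMeasurable)
    (tendsto_pi_nhds.2 fun p => ?_)
  exact ((hc p.2).tendsto p.1).comp (tendsto_gridBefore p.1)

/-! ### Limits of martingales and integration by parts. -/

section Martingale

variable {P : Measure Ω} [IsFiniteMeasure P] {ℱ : Filtration ℝ≥0 mΩ}

/-- A pointwise limit of martingales that are dominated at each time is a martingale. -/
theorem martingale_of_tendsto {N : ℕ → ℝ≥0 → Ω → ℝ} {L bound : ℝ≥0 → Ω → ℝ}
    (hN : ∀ n, Martingale (N n) ℱ P)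
    (hlim : ∀ t ω, Tendsto (fun n => N n t ω) atTop (𝓝 (L t ω)))
    (hb : ∀ t, Integrable (bound t) P) (hle : ∀ n t ω, |N n t ω| ≤ bound t ω) :
    Martingale L ℱ P := by
  have hmeas : StronglyAdapted ℱ L := fun t =>
    stronglyMeasurable_of_tendsto atTop
      (fun n => (hN n).stronglyMeasurable t) (tendsto_pi_nhds.2 (hlim t))
  refine ⟨hmeas, fun u t hut => ?_⟩
  have hLint : Integrable (L u) P := by
    refine (hb u).mono' ((hmeas u).mono (ℱ.le u)).aestronglyMeasurable (ae_of_all _ fun ω => ?_)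
    exact le_of_tendsto (hlim u ω).norm (Eventually.of_forall fun n => hle n u ω)
  -- For each `n` the variables at times `t` and `u` have the same conditional expectation given `ℱ
  -- u`; dominated convergence transfers this to the limits.
  refine (tendsto_condExp_unique (m := ℱ u) (fun n => N n t) (fun n => N n u) (L t) (L u)
    (fun n => (hN n).integrable t) (fun n => (hN n).integrable u) (ae_of_all _ (hlim t))
    (ae_of_all _ (hlim u)) _ (hb t) _ (hb u) (fun n => ae_of_all _ (hle n t))
    (fun n => ae_of_all _ (hle n u)) fun n => ?_).trans ?_
  · rw [condExp_of_stronglyMeasurable (ℱ.le u) ((hN n).stronglyMeasurable u)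
      ((hN n).integrable u)]
    exact (hN n).condExp_ae_eq hut
  · rw [condExp_of_stronglyMeasurable (ℱ.le u) (hmeas u) hLint]

theorem setIntegral_mul_eq_of_martingale {M : ℝ≥0 → Ω → ℝ} (hM : Martingale M ℱ P) {Y : Ω → ℝ}
    {u t : ℝ≥0} (hut : u ≤ t) (hY : Measurable[ℱ u] Y)
    (hint : Integrable (fun ω => M t ω * Y ω) P) {A : Set Ω} (hA : MeasurableSet[ℱ u] A) :
    ∫ ω in A, M t ω * Y ω ∂P = ∫ ω in A, M u ω * Y ω ∂P := by
  rw [← setIntegral_condExp (ℱ.le u) hint hA]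
  refine setIntegral_congr_ae (ℱ.le u _ hA) ?_
  have h1 : P[fun ω => M t ω * Y ω|ℱ u] =ᵐ[P] P[M t|ℱ u] * Y :=
    condExp_mul_of_stronglyMeasurable_right (f := M t) (g := Y)
      hY.stronglyMeasurable hint (hM.integrable t)
  filter_upwards [h1, hM.condExp_ae_eq hut] with ω h1 h2 _
  rw [h1, Pi.mul_apply, h2]

/-- Stochastic integration by parts of a martingale against an absolutely continuous process. -/
theorem martingale_mul_primitive_sub {M D : ℝ≥0 → Ω → ℝ} (hM : Martingale M ℱ P)
    (hMc : ∀ ω, IsCadlag fun t => M t ω) (hD : IsCadlagAdapted ℱ D)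
    (h1 : ∀ t : ℝ≥0, Integrable (fun p : ℝ × Ω => M t p.2 * D p.1.toNNReal p.2)
      ((volume.restrict (Set.Ioc (0 : ℝ) t)).prod P))
    (h2 : ∀ t : ℝ≥0, Integrable (fun p : ℝ × Ω => M p.1.toNNReal p.2 * D p.1.toNNReal p.2)
      ((volume.restrict (Set.Ioc (0 : ℝ) t)).prod P)) :
    Martingale (fun t ω => M t ω * primitive (fun r => D r ω) t
      - primitive (fun r => M r ω * D r ω) t) ℱ P := by
  have hMa : IsCadlagAdapted ℱ M :=
    ⟨fun t => (hM.stronglyMeasurable t).measurable, hMc⟩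
  have hNa := (hMa.mul hD.primitive).sub (hMa.mul hD).primitive
  set N : ℝ≥0 → Ω → ℝ := fun t ω => M t ω * primitive (fun r => D r ω) t
      - primitive (fun r => M r ω * D r ω) t with hN
  -- The process is the time integral of (M_t - M_r) D_r over r ≤ t, so by Fubini the martingale
  -- property can be checked for each r separately.
  have hNeq : ∀ t ω, N t ω = ∫ r in Set.Ioc (0 : ℝ) t,
      (M t ω * D r.toNNReal ω - M r.toNNReal ω * D r.toNNReal ω) := by
    intro t ω
    simp only [hN, primitive]
    rw [← intervalIntegral.integral_const_mul, ← intervalIntegral.integral_sub,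
      intervalIntegral.integral_of_le (NNReal.coe_nonneg t)]
    · exact ((hD.cadlag ω).intervalIntegrable _ _).const_mul _
    · exact (((hMa.mul hD).cadlag ω).intervalIntegrable _ _)
  have h12 : ∀ t : ℝ≥0, Integrable (fun p : ℝ × Ω =>
      M t p.2 * D p.1.toNNReal p.2 - M p.1.toNNReal p.2 * D p.1.toNNReal p.2)
      ((volume.restrict (Set.Ioc (0 : ℝ) t)).prod P) := fun t => (h1 t).sub (h2 t)
  have h12A : ∀ (t : ℝ≥0) (A : Set Ω), Integrable (fun p : ℝ × Ω =>
      M t p.2 * D p.1.toNNReal p.2 - M p.1.toNNReal p.2 * D p.1.toNNReal p.2)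
      ((volume.restrict (Set.Ioc (0 : ℝ) t)).prod (P.restrict A)) := fun t A => by
    have h := (h12 t).restrict (s := Set.univ ×ˢ A)
    rwa [← Measure.prod_restrict, Measure.restrict_univ] at h
  have hNint : ∀ t, Integrable (N t) P := fun t =>
    (h12 t).integral_prod_right.congr (ae_of_all _ fun ω => (hNeq t ω).symm)
  have hset : ∀ (t : ℝ≥0) (A : Set Ω), ∫ ω in A, N t ω ∂P
      = ∫ r in Set.Ioc (0 : ℝ) t, ∫ ω in A,
        (M t ω * D r.toNNReal ω - M r.toNNReal ω * D r.toNNReal ω) ∂P := by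
    intro t A
    simp_rw [hNeq t]
    exact integral_integral_swap (f := fun ω r =>
      M t ω * D (Real.toNNReal r) ω - M r.toNNReal ω * D r.toNNReal ω) (h12A t A).swap
  refine ⟨fun t => (hNa.adapted t).stronglyMeasurable, fun u t hut => ?_⟩
  refine (ae_eq_condExp_of_forall_setIntegral_eq (ℱ.le u) (hNint t)
    (fun _ _ _ => (hNint u).integrableOn) (fun A hA _ => ?_)
    (hNa.adapted u).stronglyMeasurable.aestronglyMeasurable).symm
  have hut' : (u : ℝ) ≤ t := hut
  have hunion := Set.Ioc_union_Ioc_eq_Ioc (NNReal.coe_nonneg u) hut'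
  have hφ : IntegrableOn (fun r : ℝ => ∫ ω in A,
      (M t ω * D r.toNNReal ω - M r.toNNReal ω * D r.toNNReal ω) ∂P) (Set.Ioc 0 t) :=
    (h12A t A).integral_prod_left
  have h1t := ae_imp_of_ae_restrict (h1 t).prod_right_ae
  have h1u := ae_imp_of_ae_restrict (h1 u).prod_right_ae
  have h2t := ae_imp_of_ae_restrict (h2 t).prod_right_ae
  rw [← hunion] at hφ
  rw [hset t A, hset u A, ← hunion, setIntegral_union (Set.Ioc_disjoint_Ioc_of_le le_rfl)
      measurableSet_Ioc hφ.left_of_union hφ.right_of_union]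
  -- For r > u the increment M_t - M_r is orthogonal to D_r on events of `ℱ u`, since these and D_r
  -- are known at time r.
  have hlate : ∫ r in Set.Ioc (u : ℝ) t, ∫ ω in A,
      (M t ω * D r.toNNReal ω - M r.toNNReal ω * D r.toNNReal ω) ∂P = 0 := by
    refine (setIntegral_congr_ae measurableSet_Ioc ?_).trans (integral_zero _ _)
    filter_upwards [h1t, h2t] with r h1r h2r hr
    have hr' : r ∈ Set.Ioc (0 : ℝ) t := ⟨u.2.trans_lt hr.1, hr.2⟩
    have hur : u ≤ r.toNNReal := NNReal.le_toNNReal_of_coe_le hr.1.le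
    rw [integral_sub (h1r hr').integrableOn (h2r hr').integrableOn,
      setIntegral_mul_eq_of_martingale hM (Real.toNNReal_le_iff_le_coe.2 hr.2)
        (hD.adapted _) (h1r hr') (ℱ.mono hur _ hA), sub_self]
  -- For r ≤ u the factor D_r is known at time u, so M_t may be replaced by M_u.
  have hearly : ∫ r in Set.Ioc (0 : ℝ) u, ∫ ω in A,
      (M t ω * D r.toNNReal ω - M r.toNNReal ω * D r.toNNReal ω) ∂P
      = ∫ r in Set.Ioc (0 : ℝ) u, ∫ ω in A,
        (M u ω * D r.toNNReal ω - M r.toNNReal ω * D r.toNNReal ω) ∂P := by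
    refine setIntegral_congr_ae measurableSet_Ioc ?_
    filter_upwards [h1t, h1u, h2t] with r h1r h1r' h2r hr
    have hr' : r ∈ Set.Ioc (0 : ℝ) t := ⟨hr.1, hr.2.trans hut'⟩
    rw [integral_sub (h1r hr').integrableOn (h2r hr').integrableOn,
      integral_sub (h1r' hr).integrableOn (h2r hr').integrableOn,
      setIntegral_mul_eq_of_martingale hM hut ((hD.adapted _).mono
        (ℱ.mono (Real.toNNReal_le_iff_le_coe.2 hr.2)) le_rfl) (h1r hr') hA]
  rw [hlate, hearly, add_zero]

end Martingale

end Adapted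

/-! ### Integrability in time and chance; products of semimartingales. -/

section TimeIntegrable

variable {Ω : Type*} [mΩ : MeasurableSpace Ω]

/-- Integrability of a process with respect to time and chance, on bounded time intervals. -/
def TimeIntegrable (P : Measure Ω) (X : ℝ≥0 → Ω → ℝ) : Prop :=
  ∀ T : ℝ≥0, Integrable (fun p : ℝ × Ω => X p.1.toNNReal p.2)
    ((volume.restrict (Set.Ioc (0 : ℝ) T)).prod P)

theorem primitive_eq_setIntegral (g : ℝ≥0 → ℝ) (t : ℝ≥0) :
    primitive g t = ∫ r in Set.Ioc (0 : ℝ) t, g r.toNNReal :=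
  intervalIntegral.integral_of_le t.2

theorem IsCadlag.abs_primitive_le {f g : ℝ≥0 → ℝ} (hg : IsCadlag g) {T : ℝ≥0}
    (h : ∀ r ≤ T, |f r| ≤ g r) {t : ℝ≥0} (ht : t ≤ T) :
    |DynASEP.primitive f t| ≤ DynASEP.primitive g T := by
  rw [primitive_eq_setIntegral, primitive_eq_setIntegral]
  have hi : IntegrableOn (fun r : ℝ => g r.toNNReal) (Set.Ioc 0 T) :=
    (intervalIntegrable_iff_integrableOn_Ioc_of_le T.2).1 (hg.intervalIntegrable _ _)
  have hsub : Set.Ioc (0 : ℝ) t ⊆ Set.Ioc 0 T := Set.Ioc_subset_Ioc_right ht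
  have hle : ∀ r ∈ Set.Ioc (0 : ℝ) T, |f r.toNNReal| ≤ g r.toNNReal := fun r hr =>
    h _ (Real.toNNReal_le_iff_le_coe.2 hr.2)
  refine (norm_integral_le_of_norm_le (f := fun r : ℝ => f r.toNNReal) (hi.mono_set hsub)
    ((ae_restrict_mem measurableSet_Ioc).mono fun r hr => hle r (hsub hr))).trans ?_
  exact setIntegral_mono_set hi ((ae_restrict_mem measurableSet_Ioc).mono fun r hr =>
    (abs_nonneg _).trans (hle r hr)) hsub.eventuallyLE

/-- Cauchy-Schwarz, obtained by integrating (g - I/T)² ≥ 0, where I/T is the mean of g. -/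
theorem IsCadlag.primitive_sq_le {g : ℝ≥0 → ℝ} (hg : IsCadlag g) (T : ℝ≥0) :
    DynASEP.primitive g T ^ 2 ≤ T * DynASEP.primitive (fun r => g r * g r) T := by
  set I := DynASEP.primitive g T with hI
  rcases eq_or_lt_of_le (NNReal.coe_nonneg T) with h0 | h0
  · simp [hI, DynASEP.primitive, ← h0]
  have hc := IsCadlag.const (I / T)
  have h1 : DynASEP.primitive (fun r => 2 * (I / T) * g r) T
      ≤ DynASEP.primitive (fun r => g r * g r + I / T * (I / T)) T :=
    ((IsCadlag.const _).mul hg).primitive_mono ((hg.mul hg).add (hc.mul hc))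
      (fun r => by nlinarith [sq_nonneg (g r - I / T)]) T
  rw [IsCadlag.primitive_const_mul, (hg.mul hg).primitive_add (hc.mul hc), ← hI] at h1
  have h2 : DynASEP.primitive (fun _ => I / T * (I / T)) T = T * (I / T * (I / T)) := by
    simp only [DynASEP.primitive, intervalIntegral.integral_const, sub_zero, smul_eq_mul]
  rw [h2] at h1
  have h3 : (T : ℝ) * (2 * (I / T) * I) = 2 * I ^ 2 := by field_simp
  have h4 : (T : ℝ) * (T * (I / T * (I / T))) = I ^ 2 := by field_simp
  nlinarith [mul_le_mul_of_nonneg_left h1 h0.le]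

section

variable {P : Measure Ω} [IsFiniteMeasure P] {ℱ : Filtration ℝ≥0 mΩ} {X Y : ℝ≥0 → Ω → ℝ}

namespace TimeIntegrable

omit [IsFiniteMeasure P] in
theorem add (hX : TimeIntegrable P X) (hY : TimeIntegrable P Y) :
    TimeIntegrable P fun t ω => X t ω + Y t ω :=
  fun T => (hX T).add (hY T)

omit [IsFiniteMeasure P] in
theorem const_mul (c : ℝ) (hX : TimeIntegrable P X) : TimeIntegrable P fun t ω => c * X t ω :=
  fun T => (hX T).const_mul c

omit [IsFiniteMeasure P] in
theorem mono (hY : TimeIntegrable P Y) (hX : IsCadlagAdapted ℱ X)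
    (h : ∀ T, ∃ c, ∀ t ≤ T, ∀ ω, |X t ω| ≤ c * Y t ω) : TimeIntegrable P X := by
  intro T
  obtain ⟨c, hc⟩ := h T
  refine ((hY T).const_mul c).mono' hX.measurable_uncurry.aestronglyMeasurable ?_
  have hmem : ∀ᵐ p ∂((volume.restrict (Set.Ioc (0 : ℝ) T)).prod P), p.1 ∈ Set.Ioc (0 : ℝ) T :=
    Measure.quasiMeasurePreserving_fst.ae (ae_restrict_mem measurableSet_Ioc)
  exact hmem.mono fun p hp => hc _ (Real.toNNReal_le_iff_le_coe.2 hp.2) _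

theorem integrable_primitive (hX : TimeIntegrable P X) (t : ℝ≥0) :
    Integrable (fun ω => DynASEP.primitive (fun r => X r ω) t) P := by
  simp_rw [primitive_eq_setIntegral]
  exact (hX t).integral_prod_right

end TimeIntegrable

theorem integrable_prod_snd {f : Ω → ℝ} (hf : Integrable f P) (T : ℝ) :
    Integrable (fun p : ℝ × Ω => f p.2) ((volume.restrict (Set.Ioc (0 : ℝ) T)).prod P) :=
  hf.comp_snd _

theorem integrable_prod_of_le {f : ℝ≥0 → Ω → ℝ} {T : ℝ≥0} {b : Ω → ℝ}
    (hf : Measurable fun p : ℝ × Ω => f p.1.toNNReal p.2) (hb : Integrable b P)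
    (h : ∀ t ≤ T, ∀ ω, |f t ω| ≤ b ω) :
    Integrable (fun p : ℝ × Ω => f p.1.toNNReal p.2)
      ((volume.restrict (Set.Ioc (0 : ℝ) T)).prod P) := by
  refine (integrable_prod_snd hb T).mono' hf.aestronglyMeasurable ?_
  have hmem : ∀ᵐ p ∂((volume.restrict (Set.Ioc (0 : ℝ) T)).prod P), p.1 ∈ Set.Ioc (0 : ℝ) T :=
    Measure.quasiMeasurePreserving_fst.ae (ae_restrict_mem measurableSet_Ioc)
  exact hmem.mono fun p hp => h _ (Real.toNNReal_le_iff_le_coe.2 hp.2) _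

theorem TimeIntegrable.primitive (hX : TimeIntegrable P X) (hXc : IsCadlagAdapted ℱ X) :
    TimeIntegrable P fun t ω => DynASEP.primitive (fun r => X r ω) t := by
  intro T
  have hab : ∀ ω, IsCadlag fun t => |X t ω| := fun ω =>
    ⟨fun t => ((hXc.cadlag ω).right t).abs, fun t => by
      obtain ⟨l, hl⟩ := (hXc.cadlag ω).left t
      exact ⟨_, hl.abs⟩⟩
  refine integrable_prod_of_le hXc.primitive.measurable_uncurry
    (b := fun ω => DynASEP.primitive (fun r => |X r ω|) T) ?_
    fun t ht ω => (hab ω).abs_primitive_le (fun _ _ => le_rfl) ht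
  simp_rw [primitive_eq_setIntegral]
  exact (hX T).abs.integral_prod_right

theorem integrable_primitive_sq (hX : TimeIntegrable P fun t ω => X t ω * X t ω)
    (hXc : IsCadlagAdapted ℱ X) (t : ℝ≥0) :
    Integrable (fun ω => primitive (fun r => X r ω) t * primitive (fun r => X r ω) t) P := by
  refine ((hX.integrable_primitive t).const_mul (t : ℝ)).mono'
    ((hXc.primitive.mul hXc.primitive).measurable t).aestronglyMeasurable (ae_of_all _ fun ω => ?_)
  rw [Real.norm_of_nonneg (mul_self_nonneg _), ← sq]
  exact (hXc.cadlag ω).primitive_sq_le t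

theorem TimeIntegrable.primitive_sq (hX : TimeIntegrable P fun t ω => X t ω * X t ω)
    (hXc : IsCadlagAdapted ℱ X) :
    TimeIntegrable P fun t ω =>
      DynASEP.primitive (fun r => X r ω) t * DynASEP.primitive (fun r => X r ω) t := by
  intro T
  refine integrable_prod_of_le (f := fun t ω =>
      DynASEP.primitive (fun r => X r ω) t * DynASEP.primitive (fun r => X r ω) t)
    (hXc.primitive.mul hXc.primitive).measurable_uncurry
    ((hX.integrable_primitive T).const_mul (T : ℝ)) fun t ht ω => ?_
  rw [abs_of_nonneg (mul_self_nonneg _), ← sq]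
  have h2 := (hXc.mul hXc).cadlag ω
  have h3 : DynASEP.primitive (fun r => X r ω * X r ω) t
      ≤ DynASEP.primitive (fun r => X r ω * X r ω) T :=
    (le_abs_self _).trans (h2.abs_primitive_le (fun r _ => (abs_mul_self _).le) ht)
  have h4 : 0 ≤ DynASEP.primitive (fun r => X r ω * X r ω) t :=
    intervalIntegral.integral_nonneg t.2 fun _ _ => mul_self_nonneg _
  exact ((hXc.cadlag ω).primitive_sq_le t).trans
    (mul_le_mul (NNReal.coe_le_coe.2 ht) h3 h4 T.2)

omit [IsFiniteMeasure P] in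
theorem TimeIntegrable.mul_of_sq (hX : TimeIntegrable P fun t ω => X t ω * X t ω)
    (hY : TimeIntegrable P fun t ω => Y t ω * Y t ω)
    (hXc : IsCadlagAdapted ℱ X) (hYc : IsCadlagAdapted ℱ Y) :
    TimeIntegrable P fun t ω => X t ω * Y t ω :=
  (hX.add hY).mono (hXc.mul hYc) fun _ => ⟨1, fun t _ ω => by
    rw [abs_le]
    constructor <;> nlinarith [sq_nonneg (X t ω + Y t ω), sq_nonneg (X t ω - Y t ω)]⟩

omit [IsFiniteMeasure P] in
theorem TimeIntegrable.sub_sq (hX : TimeIntegrable P fun t ω => X t ω * X t ω)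
    (hY : TimeIntegrable P fun t ω => Y t ω * Y t ω)
    (hXc : IsCadlagAdapted ℱ X) (hYc : IsCadlagAdapted ℱ Y) :
    TimeIntegrable P fun t ω => (X t ω - Y t ω) * (X t ω - Y t ω) :=
  (hX.add hY).mono ((hXc.sub hYc).mul (hXc.sub hYc)) fun _ => ⟨2, fun t _ ω => by
    rw [abs_of_nonneg (mul_self_nonneg _)]
    nlinarith [sq_nonneg (X t ω + Y t ω)]⟩

theorem primitive_mul_exp (c : ℝ) (t : ℝ≥0) :
    primitive (fun r => c * Real.exp (c * r)) t = Real.exp (c * t) - 1 := by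
  have hc : Continuous fun r : ℝ≥0 => c * Real.exp (c * r) := by fun_prop
  have h := (IsCadlag.of_continuous hc).integral_eq_sub
    (F := fun r => Real.exp (c * r)) (by fun_prop) (fun r hr => ?_) t
  · simpa using h
  · rw [Real.coe_toNNReal r hr, mul_comm c (Real.exp _)]
    exact (((hasDerivAt_id r).const_mul c).exp.hasDerivWithinAt).congr_deriv (by simp)

/-- Multiplication of a semimartingale by a deterministic exponential. -/
theorem martingale_exp_mul (hX : IsCadlagAdapted ℱ X) (hY : IsCadlagAdapted ℱ Y)
    (hXi : TimeIntegrable P X) (hYi : TimeIntegrable P Y)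
    (hM : Martingale (fun t ω => X t ω - primitive (fun r => Y r ω) t) ℱ P) (c : ℝ) :
    Martingale (fun (t : ℝ≥0) ω => Real.exp (c * t) * X t ω
      - primitive (fun r => Real.exp (c * r) * (Y r ω + c * X r ω)) t) ℱ P := by
  have hec : Continuous fun r : ℝ≥0 => Real.exp (c * r) := by fun_prop
  have hcec : Continuous fun r : ℝ≥0 => c * Real.exp (c * r) := by fun_prop
  have hE : IsCadlagAdapted ℱ fun (r : ℝ≥0) (_ : Ω) => Real.exp (c * r) := .of_continuous hec
  have hD : IsCadlagAdapted ℱ fun (r : ℝ≥0) (_ : Ω) => c * Real.exp (c * r) :=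
    .of_continuous hcec
  have hMa := hX.sub hY.primitive
  have hMi : TimeIntegrable P fun t ω => X t ω - primitive (fun r => Y r ω) t :=
    fun T => (hXi T).sub (hYi.primitive hY T)
  -- The primitive of c·exp(cr) is exp(ct) - 1, so adding the martingale itself back restores the
  -- factor exp(ct).
  have h := (martingale_mul_primitive_sub hM hMa.cadlag hD (fun t => ?_) fun t => ?_).add hM
  · convert h using 1
    funext t ω
    have hx := hX.cadlag ω
    have hy := hY.cadlag ω
    have he := IsCadlag.of_continuous hec
    have hce := IsCadlag.of_continuous hcec
    have hprod := hce.primitive_mul_primitive hy t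
    simp_rw [primitive_mul_exp] at hprod
    have hsplit : primitive (fun r => Real.exp (c * r) * (Y r ω + c * X r ω)) t
        = primitive (fun r => (X r ω - primitive (fun r => Y r ω) r) * (c * Real.exp (c * r))) t
          + (primitive (fun r => c * Real.exp (c * r) * primitive (fun r => Y r ω) r) t
            + primitive (fun r => (Real.exp (c * r) - 1) * Y r ω) t)
          + primitive (fun r => Y r ω) t := by
      have a1 := hce.mul hy.primitive
      have a2 := (he.sub (.const 1)).mul hy
      have a3 := (hx.sub hy.primitive).mul hce
      rw [← a1.primitive_add a2, ← a3.primitive_add (a1.add a2),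
        ← (a3.add (a1.add a2)).primitive_add hy]
      congr 1
      funext r
      ring
    simp only [Pi.add_apply, primitive_mul_exp]
    rw [hsplit, ← hprod]
    ring
  · have h1 : Integrable (fun r : ℝ => c * Real.exp (c * r.toNNReal))
        (volume.restrict (Set.Ioc (0 : ℝ) t)) :=
      (intervalIntegrable_iff_integrableOn_Ioc_of_le t.2).1
        ((IsCadlag.of_continuous hcec).intervalIntegrable _ _)
    exact (h1.mul_prod (hM.integrable t)).congr (ae_of_all _ fun p => mul_comm _ _)
  · have habs : TimeIntegrable P fun t ω => |X t ω - primitive (fun r => Y r ω) t| :=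
      fun T => (hMi T).abs
    refine habs.mono (hMa.mul hD) (fun T => ?_) t
    obtain ⟨K, hK⟩ := (IsCadlag.of_continuous hcec).exists_bound T
    refine ⟨K, fun r hr ω => ?_⟩
    rw [abs_mul, mul_comm K]
    exact mul_le_mul_of_nonneg_left (hK r hr) (abs_nonneg _)

/-- The product of two semimartingales with absolutely continuous compensators: from the
compensator of the product to the bracket of the martingale parts. -/
theorem martingale_mul_sub_bracket {DX DY G : ℝ≥0 → Ω → ℝ} (hX : IsCadlagAdapted ℱ X)
    (hY : IsCadlagAdapted ℱ Y) (hDX : IsCadlagAdapted ℱ DX) (hDY : IsCadlagAdapted ℱ DY)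
    (hG : IsCadlagAdapted ℱ G)
    (hX2 : TimeIntegrable P fun t ω => X t ω * X t ω)
    (hY2 : TimeIntegrable P fun t ω => Y t ω * Y t ω)
    (hDX2 : TimeIntegrable P fun t ω => DX t ω * DX t ω)
    (hDY2 : TimeIntegrable P fun t ω => DY t ω * DY t ω)
    (hXt : ∀ t, Integrable (fun ω => X t ω * X t ω) P)
    (hYt : ∀ t, Integrable (fun ω => Y t ω * Y t ω) P)
    (hMX : Martingale (fun t ω => X t ω - primitive (fun r => DX r ω) t) ℱ P)
    (hMY : Martingale (fun t ω => Y t ω - primitive (fun r => DY r ω) t) ℱ P)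
    (hXY : Martingale (fun t ω => X t ω * Y t ω
      - primitive (fun r => G r ω + (X r ω * DY r ω + Y r ω * DX r ω)) t) ℱ P) :
    Martingale (fun t ω => (X t ω - primitive (fun r => DX r ω) t)
      * (Y t ω - primitive (fun r => DY r ω) t) - primitive (fun r => G r ω) t) ℱ P := by
  have hmul : ∀ {U D : ℝ≥0 → Ω → ℝ} {t : ℝ≥0}, IsCadlagAdapted ℱ U → IsCadlagAdapted ℱ D →
      Integrable (fun ω => U t ω * U t ω) P → TimeIntegrable P (fun t ω => D t ω * D t ω) →
      ∀ T : ℝ≥0, Integrable (fun p : ℝ × Ω => U t p.2 * D p.1.toNNReal p.2)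
        ((volume.restrict (Set.Ioc (0 : ℝ) T)).prod P) := by
    intro U D t hU hD hU2 hD2 T
    refine ((integrable_prod_snd hU2 T).add (hD2 T)).mono'
      (((hU.measurable t).comp measurable_snd).mul hD.measurable_uncurry).aestronglyMeasurable
      (ae_of_all _ fun p => ?_)
    simp only [Pi.add_apply, Real.norm_eq_abs, abs_le]
    constructor <;> nlinarith [sq_nonneg (U t p.2 + D p.1.toNNReal p.2),
      sq_nonneg (U t p.2 - D p.1.toNNReal p.2)]
  have hsub : ∀ {U V : ℝ≥0 → Ω → ℝ} {t : ℝ≥0}, IsCadlagAdapted ℱ U → IsCadlagAdapted ℱ V →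
      Integrable (fun ω => U t ω * U t ω) P → Integrable (fun ω => V t ω * V t ω) P →
      Integrable (fun ω => (U t ω - V t ω) * (U t ω - V t ω)) P := by
    intro U V t hU hV hU2 hV2
    refine ((hU2.add hV2).const_mul 2).mono'
      (((hU.sub hV).mul (hU.sub hV)).measurable t).aestronglyMeasurable (ae_of_all _ fun ω => ?_)
    simp only [Pi.add_apply]
    rw [Real.norm_of_nonneg (mul_self_nonneg _)]
    nlinarith [sq_nonneg (U t ω + V t ω)]
  have hBX := hDX.primitive
  have hBY := hDY.primitive
  have hMXa := hX.sub hBX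
  have hMYa := hY.sub hBY
  have hMX2 := hX2.sub_sq (hDX2.primitive_sq hDX) hX hBX
  have hMY2 := hY2.sub_sq (hDY2.primitive_sq hDY) hY hBY
  -- With B_X, B_Y the primitives of `DX`, `DY` and M_X = X - B_X, M_Y = Y - B_Y, the product M_X
  -- M_Y equals XY - M_X B_Y - M_Y B_X - B_X B_Y. Integration by parts compensates the two mixed
  -- terms, and the product rule expands the last one.
  have h1 := martingale_mul_primitive_sub hMX hMXa.cadlag hDY (fun t => ?_)
    (hMX2.mul_of_sq hDY2 hMXa hDY)
  · have h2 := martingale_mul_primitive_sub hMY hMYa.cadlag hDX (fun t => ?_)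
      (hMY2.mul_of_sq hDX2 hMYa hDX)
    · convert (hXY.sub h1).sub h2 using 1
      funext t ω
      have hx := hX.cadlag ω
      have hy := hY.cadlag ω
      have hdx := hDX.cadlag ω
      have hdy := hDY.cadlag ω
      have hg := hG.cadlag ω
      have hprod := hdx.primitive_mul_primitive hdy t
      have a1 := hdx.mul hdy.primitive
      have a2 := hdx.primitive.mul hdy
      have a3 := (hx.sub hdx.primitive).mul hdy
      have a4 := (hy.sub hdy.primitive).mul hdx
      have hsplit : primitive (fun r => G r ω + (X r ω * DY r ω + Y r ω * DX r ω)) t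
          = primitive (fun r => G r ω) t
            + ((primitive (fun r => DX r ω * primitive (fun r => DY r ω) r) t
              + primitive (fun r => primitive (fun r => DX r ω) r * DY r ω) t)
            + (primitive (fun r => (X r ω - primitive (fun r => DX r ω) r) * DY r ω) t
              + primitive (fun r => (Y r ω - primitive (fun r => DY r ω) r) * DX r ω) t)) := by
        rw [← a1.primitive_add a2, ← a3.primitive_add a4, ← (a1.add a2).primitive_add (a3.add a4),
          ← hg.primitive_add ((a1.add a2).add (a3.add a4))]
        congr 1
        funext r
        ring
      simp only [Pi.sub_apply]
      rw [hsplit, ← hprod]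
      ring
    · exact hmul hMYa hDX (hsub hY hBY (hYt t) (integrable_primitive_sq hDY2 hDY t)) hDX2 t
  · exact hmul hMXa hDY (hsub hX hBX (hXt t) (integrable_primitive_sq hDX2 hDX t)) hDY2 t

end

end TimeIntegrable

/-! ### Slopes and jump rates. -/

theorem slope_cases {s : ℤ → ℝ} (hs : s ∈ stateSpace) (x : ℤ) :
    (s (x + 1) = s x + 1 ∨ s (x + 1) = s x - 1) ∧ (s (x - 1) = s x + 1 ∨ s (x - 1) = s x - 1) := by
  have h1 := hs x
  have h2 := hs (x - 1)
  rw [sub_add_cancel] at h2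
  constructor
  · rcases (abs_eq zero_le_one).1 h1 with h | h
    · left; linarith
    · right; linarith
  · rcases (abs_eq zero_le_one).1 h2 with h | h
    · right; linarith
    · left; linarith

/-- A polynomial in the slopes that agrees with the indicator of a local maximum. -/
def slopeDown (s : ℤ → ℝ) (x : ℤ) : ℝ := (1 - gradPlus s x) * (1 + gradMinus s x) / 4

/-- A polynomial in the slopes that agrees with the indicator of a local minimum. -/
def slopeUp (s : ℤ → ℝ) (x : ℤ) : ℝ := (1 + gradPlus s x) * (1 - gradMinus s x) / 4

/-- Unlike the indicator, the polynomial is continuous on all height functions, so jump rates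
evaluated along the process inherit càdlàg paths. -/
theorem etaDown_eq_slopeDown {s : ℤ → ℝ} (hs : s ∈ stateSpace) (x : ℤ) :
    etaDown s x = slopeDown s x := by
  obtain ⟨h1 | h1, h2 | h2⟩ := slope_cases hs x <;>
    norm_num [etaDown, slopeDown, gradPlus, gradMinus, h1, h2]

theorem etaUp_eq_slopeUp {s : ℤ → ℝ} (hs : s ∈ stateSpace) (x : ℤ) :
    etaUp s x = slopeUp s x := by
  obtain ⟨h1 | h1, h2 | h2⟩ := slope_cases hs x <;>
    norm_num [etaUp, slopeUp, gradPlus, gradMinus, h1, h2]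

theorem etaDown_nonneg (s : ℤ → ℝ) (x : ℤ) : 0 ≤ etaDown s x := by
  rw [etaDown]; split_ifs <;> norm_num

theorem etaUp_nonneg (s : ℤ → ℝ) (x : ℤ) : 0 ≤ etaUp s x := by
  rw [etaUp]; split_ifs <;> norm_num

theorem etaDown_add_etaUp_le (s : ℤ → ℝ) (x : ℤ) : etaDown s x + etaUp s x ≤ 1 := by
  rw [etaDown, etaUp]
  split_ifs with h1 h2
  · linarith [h1.1, h2.1]
  all_goals norm_num

section Rates

variable {q : ℝ}

theorem rateDown_nonneg (hq : 0 < q) (u : ℝ) : 0 ≤ rateDown q u := by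
  unfold rateDown; positivity

theorem rateUp_nonneg (hq : 0 < q) (u : ℝ) : 0 ≤ rateUp q u := by
  unfold rateUp; positivity

theorem rateDown_le_one (hq : 0 < q) (hq1 : q ≤ 1) (u : ℝ) : rateDown q u ≤ 1 := by
  have h : q ^ (-u + 1) = q ^ (-u) * q := by rw [Real.rpow_add hq, Real.rpow_one]
  rw [rateDown, div_le_one (by positivity), h]
  nlinarith [Real.rpow_pos_of_pos hq (-u)]

theorem rateUp_le_one (hq : 0 < q) (hq1 : q ≤ 1) (u : ℝ) : rateUp q u ≤ 1 := by
  rw [rateUp, div_le_one (by positivity)]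
  gcongr 1 + ?_
  exact Real.rpow_le_rpow_of_exponent_ge hq hq1 (by linarith)

theorem continuous_rateDown (hq : 0 < q) : Continuous (rateDown q) := by
  have h : Continuous fun u : ℝ => q ^ u := Real.continuous_const_rpow hq.ne'
  unfold rateDown
  exact ((continuous_const.mul (continuous_const.add (h.comp continuous_neg))).div
    (continuous_const.add (h.comp (continuous_neg.add continuous_const)))
    fun u => by positivity)

theorem continuous_rateUp (hq : 0 < q) : Continuous (rateUp q) := by
  have h : Continuous fun u : ℝ => q ^ u := Real.continuous_const_rpow hq.ne'
  unfold rateUp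
  exact ((continuous_const.add (h.comp continuous_neg)).div
    (continuous_const.add (h.comp (continuous_neg.sub continuous_const)))
    fun u => by positivity)

/-- Total rate of the downward jump at `x`. -/
def jumpDown (q : ℝ) (s : ℤ → ℝ) (x : ℤ) : ℝ := slopeDown s x * rateDown q (s x)

/-- Total rate of the upward jump at `x`. -/
def jumpUp (q : ℝ) (s : ℤ → ℝ) (x : ℤ) : ℝ := slopeUp s x * rateUp q (s x)

theorem continuous_jumpDown (hq : 0 < q) (x : ℤ) : Continuous fun s => jumpDown q s x := by
  have := (continuous_rateDown hq).comp (continuous_apply (A := fun _ : ℤ => ℝ) x)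
  unfold jumpDown slopeDown gradPlus gradMinus
  exact Continuous.mul (by fun_prop) this

theorem continuous_jumpUp (hq : 0 < q) (x : ℤ) : Continuous fun s => jumpUp q s x := by
  have := (continuous_rateUp hq).comp (continuous_apply (A := fun _ : ℤ => ℝ) x)
  unfold jumpUp slopeUp gradPlus gradMinus
  exact Continuous.mul (by fun_prop) this

theorem jumpDown_nonneg (hq : 0 < q) {s : ℤ → ℝ} (hs : s ∈ stateSpace) (x : ℤ) :
    0 ≤ jumpDown q s x := by
  rw [jumpDown, ← etaDown_eq_slopeDown hs]
  exact mul_nonneg (etaDown_nonneg _ _) (rateDown_nonneg hq _)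

theorem jumpUp_nonneg (hq : 0 < q) {s : ℤ → ℝ} (hs : s ∈ stateSpace) (x : ℤ) :
    0 ≤ jumpUp q s x := by
  rw [jumpUp, ← etaUp_eq_slopeUp hs]
  exact mul_nonneg (etaUp_nonneg _ _) (rateUp_nonneg hq _)

/-- A site is never both a local maximum and a local minimum, and each rate is at most 1. The bound
is uniform over the unbounded heights. -/
theorem jumpDown_add_jumpUp_le (hq : 0 < q) (hq1 : q ≤ 1) {s : ℤ → ℝ} (hs : s ∈ stateSpace)
    (x : ℤ) : jumpDown q s x + jumpUp q s x ≤ 1 := by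
  rw [jumpDown, jumpUp, ← etaDown_eq_slopeDown hs, ← etaUp_eq_slopeUp hs]
  nlinarith [etaDown_add_etaUp_le s x,
    mul_le_of_le_one_right (etaDown_nonneg s x) (rateDown_le_one hq hq1 (s x)),
    mul_le_of_le_one_right (etaUp_nonneg s x) (rateUp_le_one hq hq1 (s x))]

end Rates

/-! ### The generator and the carré du champ on local functions. -/

theorem continuous_shiftAt (x : ℤ) (h : ℝ) : Continuous fun s : ℤ → ℝ => shiftAt s x h :=
  continuous_id.update x ((continuous_apply x).add continuous_const)

theorem shiftAt_self (s : ℤ → ℝ) (x : ℤ) (h : ℝ) : shiftAt s x h x = s x + h := by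
  simp [shiftAt]

theorem shiftAt_of_ne (s : ℤ → ℝ) {x y : ℤ} (hxy : x ≠ y) (h : ℝ) : shiftAt s y h x = s x := by
  simp [shiftAt, Function.update_of_ne hxy]

theorem apply_shiftAt_of_notMem {f : (ℤ → ℝ) → ℝ} {J : Finset ℤ} (hf : DependsOn f (J : Set ℤ))
    (s : ℤ → ℝ) {x : ℤ} (hx : x ∉ J) (h : ℝ) : f (shiftAt s x h) = f s :=
  hf fun y hy => shiftAt_of_ne s (fun hxy => hx (by simpa [hxy] using hy)) h

/-- The generator with the sum restricted to the sites of `J`. -/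
def localGenerator (q : ℝ) (J : Finset ℤ) (f : (ℤ → ℝ) → ℝ) (s : ℤ → ℝ) : ℝ :=
  ∑ x ∈ J, (jumpDown q s x * (f (shiftAt s x (-2)) - f s)
    + jumpUp q s x * (f (shiftAt s x 2) - f s))

/-- The carré du champ operator with the sum restricted to the sites of `J`. -/
def carreDuChamp (q : ℝ) (J : Finset ℤ) (f g : (ℤ → ℝ) → ℝ) (s : ℤ → ℝ) : ℝ :=
  ∑ x ∈ J, (jumpDown q s x * ((f (shiftAt s x (-2)) - f s) * (g (shiftAt s x (-2)) - g s))
    + jumpUp q s x * ((f (shiftAt s x 2) - f s) * (g (shiftAt s x 2) - g s)))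

section Generator

variable {q : ℝ} {f g : (ℤ → ℝ) → ℝ} {J : Finset ℤ} {s : ℤ → ℝ}

theorem generator_eq_localGenerator (hf : DependsOn f (J : Set ℤ)) (hs : s ∈ stateSpace) :
    generator q f s = localGenerator q J f s := by
  rw [generator, localGenerator, tsum_eq_sum (s := J)]
  · refine Finset.sum_congr rfl fun x _ => ?_
    rw [jumpDown, jumpUp, etaDown_eq_slopeDown hs, etaUp_eq_slopeUp hs]
  · intro x hx
    simp [apply_shiftAt_of_notMem hf s hx]

theorem generator_const_mul (c : ℝ) : generator q (fun s => c * f s) s = c * generator q f s := by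
  rw [generator, generator, ← tsum_mul_left]
  congr 1
  funext x
  ring

theorem continuous_localGenerator (hq : 0 < q) (hf : Continuous f) :
    Continuous (localGenerator q J f) := by
  refine continuous_finsetSum _ fun x _ => ?_
  exact ((continuous_jumpDown hq x).mul ((hf.comp (continuous_shiftAt x _)).sub hf)).add
    ((continuous_jumpUp hq x).mul ((hf.comp (continuous_shiftAt x _)).sub hf))

theorem continuous_carreDuChamp (hq : 0 < q) (hf : Continuous f) (hg : Continuous g) :
    Continuous (carreDuChamp q J f g) := by
  refine continuous_finsetSum _ fun x _ => ?_
  exact ((continuous_jumpDown hq x).mul (((hf.comp (continuous_shiftAt x _)).sub hf).mul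
      ((hg.comp (continuous_shiftAt x _)).sub hg))).add
    ((continuous_jumpUp hq x).mul (((hf.comp (continuous_shiftAt x _)).sub hf).mul
      ((hg.comp (continuous_shiftAt x _)).sub hg)))

/-- For each jump, f'g' - fg = (f' - f)(g' - g) + f(g' - g) + g(f' - f). -/
theorem localGenerator_mul : localGenerator q J (fun s => f s * g s) s
    = carreDuChamp q J f g s + (f s * localGenerator q J g s + g s * localGenerator q J f s) := by
  simp only [localGenerator, carreDuChamp, Finset.mul_sum, ← Finset.sum_add_distrib]
  refine Finset.sum_congr rfl fun x _ => ?_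
  ring

theorem abs_localGenerator_le (hq : 0 < q) (hq1 : q ≤ 1) (hs : s ∈ stateSpace) {w : ℝ}
    (h0 : |f s| ≤ w) (hd : ∀ x, |f (shiftAt s x (-2))| ≤ w) (hu : ∀ x, |f (shiftAt s x 2)| ≤ w) :
    |localGenerator q J f s| ≤ J.card * (2 * w) := by
  rw [← nsmul_eq_mul]
  refine (Finset.abs_sum_le_sum_abs _ _).trans (Finset.sum_le_card_nsmul _ _ _ fun x _ => ?_)
  have hw : 0 ≤ w := (abs_nonneg _).trans h0
  have h1 := jumpDown_nonneg hq hs x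
  have h2 := jumpUp_nonneg hq hs x
  have h3 := jumpDown_add_jumpUp_le hq hq1 hs x
  have a1 : |f (shiftAt s x (-2)) - f s| ≤ 2 * w := by
    linarith [abs_sub (f (shiftAt s x (-2))) (f s), hd x]
  have a2 : |f (shiftAt s x 2) - f s| ≤ 2 * w := by
    linarith [abs_sub (f (shiftAt s x 2)) (f s), hu x]
  refine (abs_add_le _ _).trans ?_
  rw [abs_mul, abs_mul, abs_of_nonneg h1, abs_of_nonneg h2]
  nlinarith [mul_le_mul_of_nonneg_left a1 h1, mul_le_mul_of_nonneg_left a2 h2]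

/-- A nonnegative function that grows by at most a factor `1 + K` at each jump satisfies
`ℒ f ≤ K f`. -/
theorem localGenerator_singleton_le (hq : 0 < q) (hq1 : q ≤ 1) (hs : s ∈ stateSpace) {x : ℤ}
    {K : ℝ} (hK : 0 ≤ K) (h0 : 0 ≤ f s) (hd : f (shiftAt s x (-2)) ≤ (1 + K) * f s)
    (hu : f (shiftAt s x 2) ≤ (1 + K) * f s) : localGenerator q {x} f s ≤ K * f s := by
  rw [localGenerator, Finset.sum_singleton]
  have h1 := jumpDown_nonneg hq hs x
  have h2 := jumpUp_nonneg hq hs x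
  have h3 := jumpDown_add_jumpUp_le hq hq1 hs x
  have a1 : f (shiftAt s x (-2)) - f s ≤ K * f s := by linarith
  have a2 : f (shiftAt s x 2) - f s ≤ K * f s := by linarith
  nlinarith [mul_le_mul_of_nonneg_left a1 h1, mul_le_mul_of_nonneg_left a2 h2, mul_nonneg hK h0]

end Generator

/-! ### The Hopf-Cole function of a height and the discrete heat equation. -/

/-- The Hopf-Cole function `u ↦ q ^ (-u / 2) - q ^ (u / 2)` of a height. -/
def sinhHeight (q u : ℝ) : ℝ := q ^ (-(u / 2)) - q ^ (u / 2)

/-- The even companion `u ↦ q ^ (-u / 2) + q ^ (u / 2)` of the Hopf-Cole function. -/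
def coshHeight (q u : ℝ) : ℝ := q ^ (-(u / 2)) + q ^ (u / 2)

section Heights

variable {q : ℝ}

theorem continuous_sinhHeight (hq : 0 < q) : Continuous (sinhHeight q) := by
  have h : Continuous fun u : ℝ => q ^ u := Real.continuous_const_rpow hq.ne'
  exact (h.comp (by fun_prop : Continuous fun u : ℝ => -(u / 2))).sub
    (h.comp (by fun_prop : Continuous fun u : ℝ => u / 2))

theorem continuous_coshHeight (hq : 0 < q) : Continuous (coshHeight q) := by
  have h : Continuous fun u : ℝ => q ^ u := Real.continuous_const_rpow hq.ne'
  exact (h.comp (by fun_prop : Continuous fun u : ℝ => -(u / 2))).add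
    (h.comp (by fun_prop : Continuous fun u : ℝ => u / 2))

theorem coshHeight_pos (hq : 0 < q) (u : ℝ) : 0 < coshHeight q u := by
  unfold coshHeight; positivity

theorem abs_sinhHeight_le (hq : 0 < q) (u : ℝ) : |sinhHeight q u| ≤ coshHeight q u := by
  have h1 := Real.rpow_pos_of_pos hq (-(u / 2))
  have h2 := Real.rpow_pos_of_pos hq (u / 2)
  rw [sinhHeight, coshHeight, abs_le]
  constructor <;> linarith

theorem coshHeight_sq (hq : 0 < q) (u : ℝ) : coshHeight q u ^ 2 = sinhHeight q u ^ 2 + 4 := by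
  have h : q ^ (-(u / 2)) * q ^ (u / 2) = 1 := by
    rw [← Real.rpow_add hq, neg_add_cancel, Real.rpow_zero]
  rw [sinhHeight, coshHeight]
  linear_combination 4 * h

theorem coshHeight_le (hq : 0 < q) (u : ℝ) : coshHeight q u ≤ |sinhHeight q u| + 2 := by
  refine le_of_sq_le_sq ?_ (by positivity)
  rw [coshHeight_sq hq, ← sq_abs (sinhHeight q u)]
  nlinarith [abs_nonneg (sinhHeight q u)]

theorem rpow_half_add (hq : 0 < q) (u h : ℝ) : q ^ ((u + h) / 2) = q ^ (u / 2) * q ^ (h / 2) := by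
  rw [add_div, Real.rpow_add hq]

/-- The jump multiplies one exponential by q and the other by 1/q. Such multiplicative control is
why `coshHeight` serves as weight: `sinhHeight` vanishes at height 0 but not after a jump from
there. -/
theorem coshHeight_sub_two_le (hq : 0 < q) (hq1 : q ≤ 1) (u : ℝ) :
    coshHeight q (u + -2) ≤ coshHeight q u / q := by
  have h1 := Real.rpow_pos_of_pos hq (-(u / 2))
  have h2 := Real.rpow_pos_of_pos hq (u / 2)
  have e1 : q ^ (-((u + -2) / 2)) = q ^ (-(u / 2)) * q := by
    rw [show -((u + -2) / 2) = -(u / 2) + 1 by ring, Real.rpow_add hq, Real.rpow_one]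
  have e2 : q ^ ((u + -2) / 2) = q ^ (u / 2) / q := by
    rw [show (u + -2) / 2 = u / 2 - 1 by ring, Real.rpow_sub hq, Real.rpow_one]
  rw [coshHeight, coshHeight, e1, e2, le_div_iff₀ hq, add_mul, div_mul_cancel₀ _ hq.ne']
  have : q * q ≤ 1 := by nlinarith
  nlinarith

theorem coshHeight_add_two_le (hq : 0 < q) (hq1 : q ≤ 1) (u : ℝ) :
    coshHeight q (u + 2) ≤ coshHeight q u / q := by
  have h1 := Real.rpow_pos_of_pos hq (-(u / 2))
  have h2 := Real.rpow_pos_of_pos hq (u / 2)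
  have e1 : q ^ (-((u + 2) / 2)) = q ^ (-(u / 2)) / q := by
    rw [show -((u + 2) / 2) = -(u / 2) - 1 by ring, Real.rpow_sub hq, Real.rpow_one]
  have e2 : q ^ ((u + 2) / 2) = q ^ (u / 2) * q := by
    rw [show (u + 2) / 2 = u / 2 + 1 by ring, Real.rpow_add hq, Real.rpow_one]
  rw [coshHeight, coshHeight, e1, e2, le_div_iff₀ hq, add_mul, div_mul_cancel₀ _ hq.ne']
  have : q * q ≤ 1 := by nlinarith
  nlinarith

theorem le_coshHeight_div (hq : 0 < q) (hq1 : q ≤ 1) (u : ℝ) :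
    coshHeight q u ≤ coshHeight q u / q :=
  le_div_self (coshHeight_pos hq u).le hq hq1

theorem coshHeight_shiftAt_le (hq : 0 < q) (hq1 : q ≤ 1) (s : ℤ → ℝ) (x y : ℤ) {h : ℝ}
    (hh : h = -2 ∨ h = 2) : coshHeight q (shiftAt s y h x) ≤ coshHeight q (s x) / q := by
  rcases eq_or_ne x y with rfl | hxy
  · rw [shiftAt_self]
    rcases hh with rfl | rfl
    · exact coshHeight_sub_two_le hq hq1 _
    · exact coshHeight_add_two_le hq hq1 _
  · rw [shiftAt_of_ne s hxy]
    exact le_coshHeight_div hq hq1 _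

/-- With b = q^(u/2) the increment is -(1-q)(b/q)(1 + q^(-u+1)), whose last factor cancels the
denominator of the rate. -/
theorem rateDown_mul_sinhHeight (hq : 0 < q) (u : ℝ) :
    rateDown q u * (sinhHeight q (u + -2) - sinhHeight q u) = -(1 - q) * coshHeight q u := by
  have hb := Real.rpow_pos_of_pos hq (u / 2)
  have e0 : q ^ (-(u / 2)) = (q ^ (u / 2))⁻¹ := Real.rpow_neg hq.le _
  have e1 : q ^ (-((u + -2) / 2)) = q ^ (-(u / 2)) * q := by
    rw [show -((u + -2) / 2) = -(u / 2) + 1 by ring, Real.rpow_add hq, Real.rpow_one]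
  have e2 : q ^ ((u + -2) / 2) = q ^ (u / 2) / q := by
    rw [show (u + -2) / 2 = u / 2 - 1 by ring, Real.rpow_sub hq, Real.rpow_one]
  have e3 : q ^ (-u) = (q ^ (u / 2))⁻¹ ^ 2 := by
    rw [← e0, ← Real.rpow_natCast, ← Real.rpow_mul hq.le]; congr 1; push_cast; ring
  have e4 : q ^ (-u + 1) = (q ^ (u / 2))⁻¹ ^ 2 * q := by
    rw [Real.rpow_add hq, Real.rpow_one, e3]
  rw [rateDown, sinhHeight, sinhHeight, coshHeight, e1, e2, e3, e4, e0]
  generalize q ^ (u / 2) = b at *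
  field_simp
  ring

theorem rateUp_mul_sinhHeight (hq : 0 < q) (u : ℝ) :
    rateUp q u * (sinhHeight q (u + 2) - sinhHeight q u) = (1 - q) * coshHeight q u := by
  have hb := Real.rpow_pos_of_pos hq (u / 2)
  have e0 : q ^ (-(u / 2)) = (q ^ (u / 2))⁻¹ := Real.rpow_neg hq.le _
  have e1 : q ^ (-((u + 2) / 2)) = q ^ (-(u / 2)) / q := by
    rw [show -((u + 2) / 2) = -(u / 2) - 1 by ring, Real.rpow_sub hq, Real.rpow_one]
  have e2 : q ^ ((u + 2) / 2) = q ^ (u / 2) * q := by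
    rw [show (u + 2) / 2 = u / 2 + 1 by ring, Real.rpow_add hq, Real.rpow_one]
  have e3 : q ^ (-u) = (q ^ (u / 2))⁻¹ ^ 2 := by
    rw [← e0, ← Real.rpow_natCast, ← Real.rpow_mul hq.le]; congr 1; push_cast; ring
  have e4 : q ^ (-u - 1) = (q ^ (u / 2))⁻¹ ^ 2 / q := by
    rw [Real.rpow_sub hq, Real.rpow_one, e3]
  rw [rateUp, sinhHeight, sinhHeight, coshHeight, e1, e2, e3, e4, e0]
  generalize q ^ (u / 2) = b at *
  field_simp
  ring

theorem localGenerator_sinhHeight (hq : 0 < q) (s : ℤ → ℝ) (x : ℤ) :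
    localGenerator q {x} (fun s => sinhHeight q (s x)) s
      = (slopeUp s x - slopeDown s x) * (1 - q) * coshHeight q (s x) := by
  rw [localGenerator, Finset.sum_singleton, shiftAt_self, shiftAt_self, jumpDown, jumpUp,
    mul_assoc, mul_assoc, rateDown_mul_sinhHeight hq, rateUp_mul_sinhHeight hq]
  ring

/-- The algebraic identity behind the microscopic stochastic heat equation. -/
theorem localGenerator_sinhHeight_eq_laplacian (hq : 0 < q) {s : ℤ → ℝ} (hs : s ∈ stateSpace)
    (x : ℤ) : localGenerator q {x} (fun s => sinhHeight q (s x)) s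
        + theta1 q * sinhHeight q (s x)
      = theta2 q / 2 * laplacian (fun y => sinhHeight q (s y)) x := by
  have hsq : 0 < √q := Real.sqrt_pos.2 hq
  have hqq : q = √q ^ 2 := (Real.sq_sqrt hq.le).symm
  have e1 : ∀ u : ℝ, q ^ ((u + 1) / 2) = q ^ (u / 2) * √q := fun u => by
    rw [rpow_half_add hq, Real.sqrt_eq_rpow]
  have e2 : ∀ u : ℝ, q ^ ((u - 1) / 2) = q ^ (u / 2) / √q := fun u => by
    rw [sub_div, Real.rpow_sub hq, Real.sqrt_eq_rpow]
  have hb := Real.rpow_pos_of_pos hq (s x / 2)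
  rw [localGenerator_sinhHeight hq, laplacian]
  simp only [slopeUp, slopeDown, gradPlus, gradMinus, sinhHeight, coshHeight, theta1, theta2]
  -- On a straight slope no jump occurs, and the identity reads √q(√q + 1/√q - 2) = (1 - √q)², which
  -- fixes θ₁ in terms of θ₂. At an extremum the term in `coshHeight` is needed as well.
  obtain ⟨h1 | h1, h2 | h2⟩ := slope_cases hs x
  all_goals
    rw [h1, h2]
    simp only [Real.rpow_neg hq.le, e1, e2]
    clear e1 e2 h1 h2
    generalize q ^ (s x / 2) = b at *
    generalize √q = a at *
    subst hqq
    field_simp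
    ring

end Heights

/-! ### The carré du champ of the Hopf-Cole function: formula, error and upper bound. -/

section Bracket

variable {q : ℝ}

theorem sinhHeight_sub_two (hq : 0 < q) (u : ℝ) : sinhHeight q (u + -2) - sinhHeight q u
    = -(1 - q) * ((q ^ (u / 2))⁻¹ + q ^ (u / 2) / q) := by
  have e1 : q ^ (-((u + -2) / 2)) = q ^ (-(u / 2)) * q := by
    rw [show -((u + -2) / 2) = -(u / 2) + 1 by ring, Real.rpow_add hq, Real.rpow_one]
  have e2 : q ^ ((u + -2) / 2) = q ^ (u / 2) / q := by
    rw [show (u + -2) / 2 = u / 2 - 1 by ring, Real.rpow_sub hq, Real.rpow_one]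
  have hb := Real.rpow_pos_of_pos hq (u / 2)
  rw [sinhHeight, sinhHeight, e1, e2, Real.rpow_neg hq.le]
  field_simp
  ring

theorem sinhHeight_add_two (hq : 0 < q) (u : ℝ) : sinhHeight q (u + 2) - sinhHeight q u
    = (1 - q) * ((q ^ (u / 2))⁻¹ / q + q ^ (u / 2)) := by
  have e1 : q ^ (-((u + 2) / 2)) = q ^ (-(u / 2)) / q := by
    rw [show -((u + 2) / 2) = -(u / 2) - 1 by ring, Real.rpow_sub hq, Real.rpow_one]
  have e2 : q ^ ((u + 2) / 2) = q ^ (u / 2) * q := by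
    rw [show (u + 2) / 2 = u / 2 + 1 by ring, Real.rpow_add hq, Real.rpow_one]
  have hb := Real.rpow_pos_of_pos hq (u / 2)
  rw [sinhHeight, sinhHeight, e1, e2, Real.rpow_neg hq.le]
  field_simp
  ring

/-- One of the two equal increments absorbs the rate and becomes ±(1-q) times `coshHeight`; the
other stays explicit. -/
theorem carreDuChamp_sinhHeight (hq : 0 < q) (s : ℤ → ℝ) (x : ℤ) :
    carreDuChamp q {x} (fun s => sinhHeight q (s x)) (fun s => sinhHeight q (s x)) s
      = (1 - q) ^ 2 * ((q ^ (s x / 2))⁻¹ + q ^ (s x / 2))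
        * (slopeDown s x * ((q ^ (s x / 2))⁻¹ + q ^ (s x / 2) / q)
          + slopeUp s x * ((q ^ (s x / 2))⁻¹ / q + q ^ (s x / 2))) := by
  have hd := rateDown_mul_sinhHeight hq (s x)
  have hu := rateUp_mul_sinhHeight hq (s x)
  rw [carreDuChamp, Finset.sum_singleton, shiftAt_self, shiftAt_self, jumpDown, jumpUp,
    mul_assoc, mul_assoc, ← mul_assoc (rateDown q _), ← mul_assoc (rateUp q _), hd, hu,
    sinhHeight_sub_two hq, sinhHeight_add_two hq, coshHeight, Real.rpow_neg hq.le]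
  ring

/-- A jump changes a single height, so one of the two increments always vanishes. -/
theorem carreDuChamp_sinhHeight_of_ne (s : ℤ → ℝ) {x y : ℤ} (hxy : x ≠ y) (J : Finset ℤ) :
    carreDuChamp q J (fun s => sinhHeight q (s x)) (fun s => sinhHeight q (s y)) s = 0 := by
  refine Finset.sum_eq_zero fun w _ => ?_
  rcases eq_or_ne x w with rfl | hw
  · simp [shiftAt_of_ne s hxy.symm]
  · simp [shiftAt_of_ne s hw]

/-- The error term in the density of the bracket. -/
def errorTerm (ε : ℝ) (s : ℤ → ℝ) (x : ℤ) : ℝ :=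
  slopeDown s x * (2 * ((1 - Real.exp (-ε)) ^ 2 * Real.exp (-ε) / ε ^ 2 - 1))
    + slopeUp s x * (2 * ((1 - Real.exp (-ε)) ^ 2 / ε ^ 2 - 1))

theorem one_sub_exp_neg_le (ε : ℝ) : 1 - Real.exp (-ε) ≤ ε := by
  linarith [Real.add_one_le_exp (-ε)]

theorem mul_exp_neg_le (ε : ℝ) : ε * Real.exp (-ε) ≤ 1 - Real.exp (-ε) := by
  have h := Real.add_one_le_exp ε
  have h2 : Real.exp ε * Real.exp (-ε) = 1 := by rw [← Real.exp_add]; simp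
  nlinarith [Real.exp_pos (-ε)]

/-- With q = exp(-ε) and r = (1-q)²/ε², the error is 2(rq - 1) at a local maximum, 2(r - 1) at a
local minimum and 0 otherwise. Since q² ≤ r ≤ 1, both rq and r lie between q³ ≥ 1 - 3ε and 1, whence
the constant 6. -/
theorem abs_errorTerm_le {ε : ℝ} (hε : 0 < ε) {s : ℤ → ℝ} (hs : s ∈ stateSpace) (x : ℤ) :
    |errorTerm ε s x| ≤ 6 * ε := by
  have hq := Real.exp_pos (-ε)
  have hq1 : Real.exp (-ε) ≤ 1 := Real.exp_le_one_iff.2 (by linarith)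
  have h3 : 1 - 3 * ε ≤ Real.exp (-ε) ^ 3 := by
    rw [← Real.exp_nat_mul]
    push_cast
    linarith [Real.add_one_le_exp (3 * -ε)]
  have h1 := one_sub_exp_neg_le ε
  have h2 := mul_exp_neg_le ε
  simp only [errorTerm, slopeDown, slopeUp, gradPlus, gradMinus]
  set q := Real.exp (-ε)
  have hsq : (1 - q) ^ 2 ≤ ε ^ 2 := by gcongr
  have hsq' : (ε * q) ^ 2 ≤ (1 - q) ^ 2 := by gcongr
  have b1 : (1 - q) ^ 2 / ε ^ 2 ≤ 1 := (div_le_one (by positivity)).2 hsq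
  have b2 : q ^ 2 ≤ (1 - q) ^ 2 / ε ^ 2 := by
    rw [le_div_iff₀ (by positivity)]; linarith [mul_pow ε q 2]
  have e : (1 - q) ^ 2 * q / ε ^ 2 = (1 - q) ^ 2 / ε ^ 2 * q := by ring
  rw [e]
  set r := (1 - q) ^ 2 / ε ^ 2
  have b3 : q ^ 3 ≤ r * q := by nlinarith
  have b4 : r * q ≤ 1 := by nlinarith
  have b5 : q ^ 3 ≤ q ^ 2 := by nlinarith [sq_nonneg q]
  obtain ⟨h1 | h1, h2 | h2⟩ := slope_cases hs x <;> rw [h1, h2, abs_le] <;> constructor <;> nlinarith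

/-- On a straight slope both sides vanish. At an extremum the product of the slopes is -1, so the
last factor of the density is 2 plus the error, that is 2rq or 2r with r = (1-q)²/ε², which trades
ε² for (1-q)² exactly. -/
theorem exp_mul_carreDuChamp_eq_bracketDensity {ε : ℝ} (hε : 0 < ε) {s : ℤ → ℝ}
    (hs : s ∈ stateSpace) (t : ℝ) (x y : ℤ) (J : Finset ℤ)
    (hJ : x = y → J = {x}) :
    Real.exp (2 * theta1 (Real.exp (-ε)) * t) * carreDuChamp (Real.exp (-ε)) J
        (fun s => sinhHeight (Real.exp (-ε)) (s y)) (fun s => sinhHeight (Real.exp (-ε)) (s x)) s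
      = bracketDensity ε t y x s (errorTerm ε s x) := by
  rw [bracketDensity]
  split_ifs with hxy
  swap
  · rw [carreDuChamp_sinhHeight_of_ne s (Ne.symm hxy), mul_zero]
  subst hxy
  have hq := Real.exp_pos (-ε)
  rw [hJ rfl, carreDuChamp_sinhHeight hq]
  simp only [errorTerm, slopeDown, slopeUp, gradPlus, gradMinus]
  rw [show 2 * theta1 (Real.exp (-ε)) * t = 2 * t * theta1 (Real.exp (-ε)) by ring]
  generalize Real.exp (2 * t * theta1 (Real.exp (-ε))) = E
  generalize Real.exp (-ε) = q at *
  have hb := Real.rpow_pos_of_pos hq (s x / 2)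
  have e0 : q ^ (-s x) = (q ^ (s x / 2))⁻¹ ^ 2 := by
    rw [← Real.rpow_neg hq.le, ← Real.rpow_natCast, ← Real.rpow_mul hq.le]
    congr 1; push_cast; ring
  have e1 : q ^ (s x) = (q ^ (s x / 2)) ^ 2 := by
    rw [← Real.rpow_natCast, ← Real.rpow_mul hq.le]; congr 1; push_cast; ring
  have e2 : q ^ ((s x + 1 + (s x + 1)) / 2) = (q ^ (s x / 2)) ^ 2 * q := by
    rw [← e1, show (s x + 1 + (s x + 1)) / 2 = s x + 1 by ring, Real.rpow_add hq, Real.rpow_one]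
  have e3 : q ^ ((s x - 1 + (s x - 1)) / 2) = (q ^ (s x / 2)) ^ 2 / q := by
    rw [← e1, show (s x - 1 + (s x - 1)) / 2 = s x - 1 by ring, Real.rpow_sub hq, Real.rpow_one]
  rw [e0]
  obtain ⟨h1 | h1, h2 | h2⟩ := slope_cases hs x
  · rw [h1, h2, e2]
    clear e0 e1 e2 e3
    generalize q ^ (s x / 2) = b at *
    field_simp
    ring
  · rw [h1, h2]
    ring
  · rw [h1, h2]
    ring
  · rw [h1, h2, e3]
    clear e0 e1 e2 e3
    generalize q ^ (s x / 2) = b at *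
    field_simp
    ring

/-- This is the upper bound on the carré du champ divided by ε², where X is q^(s x) at a local
maximum and its inverse at a local minimum, k = (1-q)²/(qε²) and m = (1-q)²/ε². The right side is
2(sinh² + 2) with sinh² = X + 1/X - 2. -/
theorem quadratic_bound {ε k m X : ℝ} (hε : 0 ≤ ε) (hε1 : ε ≤ 1) (hk : k ≤ 1 + ε / 3)
    (hm : m ≤ 1 - 5 * ε / 9) (hX : 0 < X) : k * X + k + m + m / X ≤ 2 * (X + X⁻¹) := by
  have hXi := inv_pos.2 hX
  have h1 : k * X + k + m + m / X ≤ (1 + ε / 3) * X + (1 + ε / 3) + (1 - 5 * ε / 9)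
      + (1 - 5 * ε / 9) / X := by gcongr
  refine h1.trans ?_
  rw [← sub_nonneg]
  have h2 : 2 * (X + X⁻¹) - ((1 + ε / 3) * X + (1 + ε / 3) + (1 - 5 * ε / 9)
      + (1 - 5 * ε / 9) / X)
      = ((1 - ε / 3) * X ^ 2 - (2 - 2 * ε / 9) * X + (1 + 5 * ε / 9)) / X := by
    field_simp
    ring
  rw [h2]
  refine div_nonneg ?_ hX.le
  -- Completing the square leaves the remainder (4ε/9)(1 - 4ε/9) ≥ 0.
  have h3 : 0 ≤ (1 - ε / 3) * ((1 - ε / 3) * X ^ 2 - (2 - 2 * ε / 9) * X + (1 + 5 * ε / 9)) := by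
    nlinarith [sq_nonneg ((1 - ε / 3) * X - (1 - ε / 9))]
  exact nonneg_of_mul_nonneg_right h3 (by linarith)

theorem exp_neg_lower_bound {ε : ℝ} (hε : 0 ≤ ε) (hε1 : ε ≤ 1) :
    1 - ε + ε ^ 2 / 3 ≤ Real.exp (-ε)
      ∧ 1 ≤ Real.exp (-ε) * (1 + ε + ε ^ 2 / 2 + ε ^ 3 / 4) := by
  have hq := Real.exp_pos (-ε)
  have h1 : Real.exp ε ≤ 1 + ε + ε ^ 2 / 2 + ε ^ 3 / 4 := by
    -- The third-order Taylor remainder is at most 2ε³/9, rounded up to ε³/4.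
    have h := Real.exp_bound' hε hε1 (n := 3) (by norm_num)
    norm_num [Finset.sum_range_succ, Nat.factorial] at h
    nlinarith [pow_nonneg hε 3]
  have h2 : Real.exp (-ε) * Real.exp ε = 1 := by rw [← Real.exp_add]; simp
  have h3 : 1 ≤ Real.exp (-ε) * (1 + ε + ε ^ 2 / 2 + ε ^ 3 / 4) := by
    calc 1 = Real.exp (-ε) * Real.exp ε := h2.symm
      _ ≤ _ := by gcongr
  refine ⟨?_, h3⟩
  have h4 : (1 - ε + ε ^ 2 / 3) * (1 + ε + ε ^ 2 / 2 + ε ^ 3 / 4) ≤ 1 := by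
    nlinarith [pow_nonneg hε 2, pow_nonneg hε 3, pow_nonneg hε 4,
      mul_nonneg (pow_nonneg hε 2) (sub_nonneg.2 hε1), mul_nonneg (pow_nonneg hε 4) (sub_nonneg.2 hε1)]
  exact le_of_mul_le_mul_right (h4.trans h3) (by positivity)

theorem carreDuChamp_sinhHeight_le {ε : ℝ} (hε : 0 < ε) (hε1 : ε ≤ 1) {s : ℤ → ℝ}
    (hs : s ∈ stateSpace) (x : ℤ) :
    carreDuChamp (Real.exp (-ε)) {x} (fun s => sinhHeight (Real.exp (-ε)) (s x))
        (fun s => sinhHeight (Real.exp (-ε)) (s x)) s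
      ≤ 2 * ε ^ 2 * (sinhHeight (Real.exp (-ε)) (s x) ^ 2 + 2) := by
  have hq := Real.exp_pos (-ε)
  obtain ⟨hl, hi⟩ := exp_neg_lower_bound hε.le hε1
  have hq1 : Real.exp (-ε) ≤ 1 := Real.exp_le_one_iff.2 (by linarith)
  rw [carreDuChamp_sinhHeight hq, sinhHeight, Real.rpow_neg hq.le]
  simp only [slopeDown, slopeUp, gradPlus, gradMinus]
  generalize Real.exp (-ε) = q at *
  have hb := Real.rpow_pos_of_pos hq (s x / 2)
  generalize q ^ (s x / 2) = b at *
  have hm : (1 - q) ^ 2 / ε ^ 2 ≤ 1 - 5 * ε / 9 := by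
    rw [div_le_iff₀ (by positivity)]
    -- The lower bound on q gives 1 - q ≤ ε(1 - ε/3), and (1 - ε/3)² ≤ 1 - 5ε/9 because ε² ≤ ε.
    have h1 : (1 - q) ^ 2 ≤ (ε * (1 - ε / 3)) ^ 2 := by
      gcongr
      nlinarith
    nlinarith [pow_pos hε 3, pow_pos hε 4]
  have hk : (1 - q) ^ 2 / (q * ε ^ 2) ≤ 1 + ε / 3 := by
    rw [div_le_iff₀ (by positivity)]
    have h1 : (1 - q) ^ 2 ≤ (ε * (1 - ε / 3)) ^ 2 := by
      gcongr
      nlinarith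
    have h2 : (1 - ε / 3) ^ 2 * (1 + ε + ε ^ 2 / 2 + ε ^ 3 / 4) ≤ 1 + ε / 3 := by
      nlinarith [pow_nonneg hε.le 2, pow_nonneg hε.le 3, pow_nonneg hε.le 4,
        mul_nonneg (pow_nonneg hε.le 2) (sub_nonneg.2 hε1),
        mul_nonneg (pow_nonneg hε.le 4) (sub_nonneg.2 hε1)]
    have h3 : (1 - ε / 3) ^ 2 ≤ (1 + ε / 3) * q := by
      calc (1 - ε / 3) ^ 2 ≤ (1 - ε / 3) ^ 2 * (q * (1 + ε + ε ^ 2 / 2 + ε ^ 3 / 4)) :=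
            le_mul_of_one_le_right (sq_nonneg _) hi
        _ = (1 - ε / 3) ^ 2 * (1 + ε + ε ^ 2 / 2 + ε ^ 3 / 4) * q := by ring
        _ ≤ _ := by gcongr
    nlinarith [mul_le_mul_of_nonneg_left h3 (sq_nonneg ε)]
  have hp : 0 < b ^ 2 := by positivity
  have hp' : 0 < (b ^ 2)⁻¹ := by positivity
  obtain ⟨h1 | h1, h2 | h2⟩ := slope_cases hs x
  · have h := mul_le_mul_of_nonneg_left (quadratic_bound hε.le hε1 hk hm hp') (sq_nonneg ε)
    rw [h1, h2]
    refine (le_of_eq ?_).trans (h.trans (le_of_eq ?_)) <;> field_simp <;> ring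
  · rw [h1, h2]
    have : (0 : ℝ) ≤ 2 * ε ^ 2 * ((b⁻¹ - b) ^ 2 + 2) := by positivity
    linarith
  · rw [h1, h2]
    have : (0 : ℝ) ≤ 2 * ε ^ 2 * ((b⁻¹ - b) ^ 2 + 2) := by positivity
    linarith
  · have h := mul_le_mul_of_nonneg_left (quadratic_bound hε.le hε1 hk hm hp) (sq_nonneg ε)
    rw [h1, h2]
    refine (le_of_eq ?_).trans (h.trans (le_of_eq ?_)) <;> field_simp <;> ring

end Bracket

/-! ### Dynkin's formula beyond bounded functions. -/

section Dynkin

variable {Ω : Type*} [mΩ : MeasurableSpace Ω] {P : Measure Ω} {q : ℝ} {s : ℝ≥0 → Ω → ℤ → ℝ}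

theorem IsDynamicASEP.isCadlagAdapted_comp (hs : IsDynamicASEP q P s) {f : (ℤ → ℝ) → ℝ}
    (hf : Continuous f) : IsCadlagAdapted hs.filtration fun t ω => f (s t ω) where
  adapted t := hf.measurable.comp
    (Filtration.stronglyAdapted_natural hs.stronglyMeasurable t).measurable
  cadlag ω := ⟨fun t => hf.continuousAt.comp_continuousWithinAt (hs.right_continuous ω t),
    fun t => by
      obtain ⟨l, hl⟩ := hs.left_limits ω t
      exact ⟨f l, (hf.tendsto l).comp hl⟩⟩

theorem IsDynamicASEP.martingale_of_bounded (hs : IsDynamicASEP q P s) {f : (ℤ → ℝ) → ℝ}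
    {J : Finset ℤ} (hf : Continuous f) (hJ : DependsOn f (J : Set ℤ)) {K : ℝ}
    (hK : ∀ s, |f s| ≤ K) :
    Martingale (fun t ω => f (s t ω) - primitive (fun r => localGenerator q J f (s r ω)) t)
      hs.filtration P := by
  have h := hs.martingale_problem f ⟨hf.measurable, ⟨K, hK⟩, ⟨J, hJ⟩⟩
  rw [IsDynamicASEP.filtration]
  convert h using 1
  funext t ω
  simp only [primitive, generator_eq_localGenerator hJ (hs.mem_stateSpace _ _)]

/-- Truncation of a real number to `[-n, n]`. -/
def clamp (n : ℕ) (v : ℝ) : ℝ := max (-n) (min n v)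

theorem abs_clamp_le (n : ℕ) (v : ℝ) : |clamp n v| ≤ n := by
  have : (0 : ℝ) ≤ n := n.cast_nonneg
  exact abs_le.2 ⟨le_max_left _ _, max_le (by linarith) (min_le_left _ _)⟩

theorem abs_clamp_le_abs (n : ℕ) (v : ℝ) : |clamp n v| ≤ |v| := by
  have hn : (0 : ℝ) ≤ n := n.cast_nonneg
  refine abs_le.2 ⟨?_, max_le (by linarith [abs_nonneg v])
    ((min_le_right _ _).trans (le_abs_self v))⟩
  exact le_max_of_le_right (le_min (by linarith [abs_nonneg v]) (neg_abs_le v))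

theorem continuous_clamp (n : ℕ) : Continuous (clamp n) := by unfold clamp; fun_prop

theorem eventually_clamp_eq (v : ℝ) : ∀ᶠ n : ℕ in atTop, clamp n v = v := by
  obtain ⟨N, hN⟩ := exists_nat_ge |v|
  filter_upwards [eventually_ge_atTop N] with n hn
  have h : |v| ≤ n := hN.trans (by exact_mod_cast hn)
  rw [clamp, min_eq_right (le_of_abs_le h), max_eq_right (neg_le_of_abs_le h)]

theorem tendsto_clamp (v : ℝ) : Tendsto (fun n => clamp n v) atTop (𝓝 v) :=
  tendsto_const_nhds.congr' ((eventually_clamp_eq v).mono fun _ h => h.symm)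

theorem abs_clamp_min_le {w : ℝ} (n : ℕ) {v : ℝ} (h : |v| ≤ w) : |clamp n v| ≤ w :=
  (abs_clamp_le_abs n v).trans h

/-- **Dynkin's formula** for a continuous local function whose values before and after a jump are
dominated by an integrable weight. -/
theorem IsDynamicASEP.martingale_of_dominated [IsFiniteMeasure P] (hq : 0 < q) (hq1 : q ≤ 1)
    (hs : IsDynamicASEP q P s) {f w : (ℤ → ℝ) → ℝ} {J : Finset ℤ} (hf : Continuous f)
    (hJ : DependsOn f (J : Set ℤ)) (hw : Continuous w) (h0 : ∀ s, |f s| ≤ w s)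
    (hd : ∀ s x, |f (shiftAt s x (-2))| ≤ w s) (hu : ∀ s x, |f (shiftAt s x 2)| ≤ w s)
    (hint : ∀ t, Integrable (fun ω => w (s t ω)) P)
    (htime : TimeIntegrable P fun t ω => w (s t ω)) :
    Martingale (fun t ω => f (s t ω) - primitive (fun r => localGenerator q J f (s r ω)) t)
      hs.filtration P := by
  have hgw : Continuous fun s => J.card * (2 * w s) := by fun_prop
  have hcont : ∀ n, Continuous fun s => clamp n (f s) := fun n => (continuous_clamp n).comp hf
  -- Clamping does not increase absolute values, so the same weight controls the generator of every
  -- truncation, uniformly in `n`.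
  have hle : ∀ n t ω, |localGenerator q J (fun s => clamp n (f s)) (s t ω)|
      ≤ J.card * (2 * w (s t ω)) := fun n t ω =>
    abs_localGenerator_le (f := fun s => clamp n (f s)) hq hq1 (hs.mem_stateSpace t ω)
      (abs_clamp_min_le n (h0 _)) (fun x => abs_clamp_min_le n (hd _ x))
      fun x => abs_clamp_min_le n (hu _ x)
  refine martingale_of_tendsto (N := fun n t ω => clamp n (f (s t ω))
    - primitive (fun r => localGenerator q J (fun s => clamp n (f s)) (s r ω)) t)
    (bound := fun t ω => w (s t ω) + primitive (fun r => J.card * (2 * w (s r ω))) t)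
    (fun n => ?_) (fun t ω => ?_) (fun t => ?_) fun n t ω => ?_
  · exact hs.martingale_of_bounded (hcont n)
      (fun a b hab => by simp only [hJ hab]) (K := n) fun s => abs_clamp_le n _
  · refine (tendsto_clamp _).sub ?_
    refine intervalIntegral.tendsto_integral_filter_of_dominated_convergence
      (fun r : ℝ => J.card * (2 * w (s r.toNNReal ω))) (Eventually.of_forall fun n => ?_)
      (Eventually.of_forall fun n => ae_of_all _ fun r _ => hle n _ ω)
      (((hs.isCadlagAdapted_comp hgw).cadlag ω).intervalIntegrable _ _)
      (ae_of_all _ fun r _ => ?_)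
    · exact ((hs.isCadlagAdapted_comp
        (continuous_localGenerator hq (hcont n))).cadlag ω).measurable_toNNReal.aestronglyMeasurable
    · refine tendsto_finsetSum _ fun x _ => ?_
      exact ((tendsto_const_nhds.mul ((tendsto_clamp _).sub (tendsto_clamp _))).add
        (tendsto_const_nhds.mul ((tendsto_clamp _).sub (tendsto_clamp _))))
  · exact (hint t).add (((htime.const_mul 2).const_mul J.card).integrable_primitive t)
  · refine (abs_sub _ _).trans (add_le_add (abs_clamp_min_le n (h0 _)) ?_)
    exact ((hs.isCadlagAdapted_comp hgw).cadlag ω).abs_primitive_le (fun r _ => hle n r ω) le_rfl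

end Dynkin

/-! ### Propagation of exponential moments. -/

section Moments

variable {Ω : Type*} [mΩ : MeasurableSpace Ω] {P : Measure Ω} [IsProbabilityMeasure P] {q : ℝ}
  {s : ℝ≥0 → Ω → ℤ → ℝ}

/-- A Gronwall bound: with K = q^(-p) - 1 the truncated power f satisfies ℒf ≤ Kf, so exp(-Kt)
f(s_t) has a nonpositive compensator and its mean cannot exceed the initial one. Truncation at `n`
keeps f bounded without spoiling the growth factor, because 1 + K ≥ 1. -/
theorem integral_truncated_moment_le (hq : 0 < q) (hq1 : q ≤ 1) (hs : IsDynamicASEP q P s)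
    (x : ℤ) (p n : ℕ) (t : ℝ≥0) :
    ∫ ω, min (coshHeight q (s t ω x) ^ p) n ∂P
      ≤ Real.exp (((1 / q) ^ p - 1) * t) * ∫ ω, min (coshHeight q (s 0 ω x) ^ p) n ∂P := by
  set f : (ℤ → ℝ) → ℝ := fun s => min (coshHeight q (s x) ^ p) n with hf
  set K : ℝ := (1 / q) ^ p - 1 with hK
  have hqp : 1 ≤ (1 / q) ^ p := one_le_pow₀ ((one_le_div hq).2 hq1)
  have hK0 : 0 ≤ K := by linarith
  have hfc : Continuous f :=
    (((continuous_coshHeight hq).comp (continuous_apply x)).pow p).min continuous_const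
  have hf0 : ∀ s, 0 ≤ f s := fun s => le_min (pow_pos (coshHeight_pos hq _) p).le n.cast_nonneg
  have hfn : ∀ s, |f s| ≤ n := fun s => by rw [abs_of_nonneg (hf0 s)]; exact min_le_right _ _
  have hJ : DependsOn f (({x} : Finset ℤ) : Set ℤ) := fun a b hab => by
    simp only [hf, hab x (by simp)]
  have hstep : ∀ (s : ℤ → ℝ) (h : ℝ), h = -2 ∨ h = 2 → f (shiftAt s x h) ≤ (1 + K) * f s := by
    intro s h hh
    have h1 := coshHeight_shiftAt_le hq hq1 s x x hh
    have h2 : coshHeight q (shiftAt s x h x) ^ p ≤ (1 / q) ^ p * coshHeight q (s x) ^ p := by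
      rw [← mul_pow, one_div_mul_eq_div]
      exact pow_le_pow_left₀ (coshHeight_pos hq _).le h1 p
    simp only [hf, hK, add_sub_cancel]
    rw [mul_min_of_nonneg _ _ (by positivity)]
    exact min_le_min h2 (le_mul_of_one_le_left n.cast_nonneg hqp)
  have hgen : ∀ t ω, localGenerator q {x} f (s t ω) ≤ K * f (s t ω) := fun t ω =>
    localGenerator_singleton_le hq hq1 (hs.mem_stateSpace t ω) hK0 (hf0 _)
      (hstep _ _ (Or.inl rfl)) (hstep _ _ (Or.inr rfl))
  have hXa := hs.isCadlagAdapted_comp hfc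
  have hGa := hs.isCadlagAdapted_comp (continuous_localGenerator (J := {x}) hq hfc)
  have hbdd : ∀ {X : ℝ≥0 → Ω → ℝ} {C : ℝ}, IsCadlagAdapted hs.filtration X →
      (∀ t ω, |X t ω| ≤ C) → TimeIntegrable P X := fun {X C} hX hC T =>
    integrable_prod_of_le hX.measurable_uncurry (integrable_const C) fun t _ ω => hC t ω
  have hXi := hbdd hXa fun t ω => hfn _
  have hGi := hbdd hGa fun t ω => abs_localGenerator_le hq hq1 (hs.mem_stateSpace t ω) (hfn _)
    (fun _ => hfn _) fun _ => hfn _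
  have hM := martingale_exp_mul hXa hGa hXi hGi (hs.martingale_of_bounded hfc hJ hfn) (-K)
  have hM2 := hM.setIntegral_eq (zero_le (a := t)) MeasurableSet.univ
  have hprim : ∀ ω, primitive (fun r => Real.exp (-K * r)
      * (localGenerator q {x} f (s r ω) + -K * f (s r ω))) t ≤ 0 := by
    intro ω
    rw [primitive_eq_setIntegral]
    refine integral_nonpos fun r => ?_
    refine mul_nonpos_of_nonneg_of_nonpos (Real.exp_nonneg _) ?_
    linarith [hgen r.toNNReal ω]
  have hft : ∀ t, Integrable (fun ω => f (s t ω)) P := fun t =>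
    (integrable_const (n : ℝ)).mono' (hXa.measurable t).aestronglyMeasurable
      (ae_of_all _ fun ω => hfn _)
  have h1 : Real.exp (-K * t) * ∫ ω, f (s t ω) ∂P ≤ ∫ ω, f (s 0 ω) ∂P := by
    rw [setIntegral_univ, setIntegral_univ] at hM2
    rw [← integral_const_mul]
    refine (integral_mono ((hft t).const_mul _) (hM.integrable t) fun ω => ?_).trans
      (hM2.symm.trans ?_).le
    · simp only
      linarith [hprim ω]
    · simp [primitive]
  calc ∫ ω, f (s t ω) ∂P = Real.exp (K * t) * (Real.exp (-K * t) * ∫ ω, f (s t ω) ∂P) := by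
        rw [← mul_assoc, ← Real.exp_add]; simp
    _ ≤ _ := by gcongr

/-- Monotone convergence removes the truncation. The bound is uniform on bounded time intervals, so
Tonelli gives integrability in time and chance too. -/
theorem moment_bound (hq : 0 < q) (hq1 : q ≤ 1) (hs : IsDynamicASEP q P s) (x : ℤ) (p : ℕ)
    (h0 : Integrable (fun ω => coshHeight q (s 0 ω x) ^ p) P) :
    (∀ t, Integrable (fun ω => coshHeight q (s t ω x) ^ p) P)
      ∧ TimeIntegrable P fun t ω => coshHeight q (s t ω x) ^ p := by
  set K : ℝ := (1 / q) ^ p - 1 with hK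
  have hK0 : 0 ≤ K := by
    have hqp : 1 ≤ (1 / q) ^ p := one_le_pow₀ ((one_le_div hq).2 hq1)
    linarith
  set C : ℝ := ∫ ω, coshHeight q (s 0 ω x) ^ p ∂P with hC
  have hC0 : 0 ≤ C := integral_nonneg fun ω => (pow_pos (coshHeight_pos hq _) p).le
  have hV0 : ∀ t ω, 0 ≤ coshHeight q (s t ω x) ^ p := fun t ω =>
    (pow_pos (coshHeight_pos hq _) p).le
  have hXa := hs.isCadlagAdapted_comp (f := fun s => coshHeight q (s x) ^ p)
    (((continuous_coshHeight hq).comp (continuous_apply x)).pow p)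
  have hXn : ∀ n : ℕ, IsCadlagAdapted hs.filtration
      fun t ω => min (coshHeight q (s t ω x) ^ p) n := fun n =>
    hs.isCadlagAdapted_comp (f := fun s => min (coshHeight q (s x) ^ p) n)
      ((((continuous_coshHeight hq).comp (continuous_apply x)).pow p).min continuous_const)
  have hint : ∀ (n : ℕ) t, Integrable (fun ω => min (coshHeight q (s t ω x) ^ p) n) P := fun n t =>
    (integrable_const (n : ℝ)).mono' ((hXn n).measurable t).aestronglyMeasurable
      (ae_of_all _ fun ω => by
        rw [Real.norm_of_nonneg (le_min (hV0 t ω) n.cast_nonneg)]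
        exact min_le_right _ _)
  have hl : ∀ t : ℝ≥0, ∫⁻ ω, ENNReal.ofReal (coshHeight q (s t ω x) ^ p) ∂P
      ≤ ENNReal.ofReal (Real.exp (K * t) * C) := by
    intro t
    refine le_of_tendsto' (lintegral_tendsto_of_tendsto_of_monotone
      (f := fun (n : ℕ) ω => ENNReal.ofReal (min (coshHeight q (s t ω x) ^ p) n))
      (fun n => ((hXn n).measurable t).ennreal_ofReal.aemeasurable)
      (ae_of_all _ fun ω m n hmn => ENNReal.ofReal_le_ofReal
        (min_le_min_left _ (by exact_mod_cast hmn)))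
      (ae_of_all _ fun ω => ?_)) fun n => ?_
    · obtain ⟨N, hN⟩ := exists_nat_ge (coshHeight q (s t ω x) ^ p)
      refine tendsto_const_nhds.congr' ((eventually_ge_atTop N).mono fun n hn => ?_)
      simp only [min_eq_left (hN.trans (Nat.cast_le.2 hn : (N : ℝ) ≤ n))]
    · rw [← ofReal_integral_eq_lintegral_ofReal (hint n t)
        (ae_of_all _ fun ω => le_min (hV0 t ω) n.cast_nonneg)]
      refine ENNReal.ofReal_le_ofReal ((integral_truncated_moment_le hq hq1 hs x p n t).trans ?_)
      gcongr
      exact integral_mono (hint n 0) h0 fun ω => min_le_left _ _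
  refine ⟨fun t => ⟨(hXa.measurable t).aestronglyMeasurable, ?_⟩, fun T =>
    ⟨hXa.measurable_uncurry.aestronglyMeasurable, ?_⟩⟩
  · rw [hasFiniteIntegral_iff_ofReal (ae_of_all _ (hV0 t))]
    exact (hl t).trans_lt ENNReal.ofReal_lt_top
  · rw [hasFiniteIntegral_iff_ofReal (ae_of_all _ fun p => hV0 _ _),
      lintegral_prod _ hXa.measurable_uncurry.ennreal_ofReal.aemeasurable]
    refine (setLIntegral_mono' (g := fun _ => ENNReal.ofReal (Real.exp (K * T) * C))
      measurableSet_Ioc fun r hr => (hl _).trans (ENNReal.ofReal_le_ofReal ?_)).trans_lt ?_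
    · gcongr
      exact Real.toNNReal_le_iff_le_coe.2 hr.2
    · rw [setLIntegral_const, Real.volume_Ioc]
      exact ENNReal.mul_lt_top ENNReal.ofReal_lt_top ENNReal.ofReal_lt_top

end Moments

/-! ### The process Z, its martingale part and the bracket. -/

section HopfCole

variable {Ω : Type*} [mΩ : MeasurableSpace Ω] {P : Measure Ω} {q : ℝ} {s : ℝ≥0 → Ω → ℤ → ℝ}

theorem continuous_sinhHeight_apply (hq : 0 < q) (x : ℤ) :
    Continuous fun s : ℤ → ℝ => sinhHeight q (s x) :=
  (continuous_sinhHeight hq).comp (continuous_apply x)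

theorem continuous_coshHeight_apply (hq : 0 < q) (x : ℤ) :
    Continuous fun s : ℤ → ℝ => coshHeight q (s x) :=
  (continuous_coshHeight hq).comp (continuous_apply x)

theorem dependsOn_sinhHeight {x : ℤ} {J : Finset ℤ} (hx : x ∈ J) :
    DependsOn (fun s : ℤ → ℝ => sinhHeight q (s x)) (J : Set ℤ) := fun a b hab => by
  simp only [hab x (by simpa using hx)]

/-- The drift of the Hopf-Cole function of the height at `x`. -/
def sinhDrift (q : ℝ) (x : ℤ) (s : ℤ → ℝ) : ℝ :=
  localGenerator q {x} (fun s => sinhHeight q (s x)) s + theta1 q * sinhHeight q (s x)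

theorem continuous_sinhDrift (hq : 0 < q) (x : ℤ) : Continuous (sinhDrift q x) :=
  (continuous_localGenerator hq (continuous_sinhHeight_apply hq x)).add
    (continuous_const.mul (continuous_sinhHeight_apply hq x))

omit mΩ in
theorem Z_eq (t : ℝ≥0) (x : ℤ) (ω : Ω) :
    Z q s t x ω = Real.exp (theta1 q * t) * sinhHeight q (s t ω x) := rfl

theorem IsDynamicASEP.localGenerator_sinhHeight_eq (hs : IsDynamicASEP q P s) {x : ℤ}
    {J : Finset ℤ} (hx : x ∈ J) (t : ℝ≥0) (ω : Ω) :
    localGenerator q {x} (fun s => sinhHeight q (s x)) (s t ω)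
      = localGenerator q J (fun s => sinhHeight q (s x)) (s t ω) := by
  rw [← generator_eq_localGenerator (dependsOn_sinhHeight (by simp)) (hs.mem_stateSpace t ω),
    ← generator_eq_localGenerator (dependsOn_sinhHeight hx) (hs.mem_stateSpace t ω)]

theorem IsDynamicASEP.drift_eq (hs : IsDynamicASEP q P s) (t : ℝ≥0) (x : ℤ) (ω : Ω) :
    drift q s t x ω = Real.exp (theta1 q * t) * sinhDrift q x (s t ω) := by
  have h : generator q (hopfCole q t x) (s t ω) = Real.exp (theta1 q * t)
      * generator q (fun s => sinhHeight q (s x)) (s t ω) := generator_const_mul _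
  rw [drift, h, Z_eq, sinhDrift,
    generator_eq_localGenerator (dependsOn_sinhHeight (J := {x}) (by simp))
      (hs.mem_stateSpace t ω)]
  ring

theorem IsDynamicASEP.drift_eq_laplacian (hq : 0 < q) (hs : IsDynamicASEP q P s) (t : ℝ≥0)
    (x : ℤ) (ω : Ω) :
    drift q s t x ω = theta2 q / 2 * laplacian (fun y => Z q s t y ω) x := by
  rw [hs.drift_eq, sinhDrift,
    localGenerator_sinhHeight_eq_laplacian hq (hs.mem_stateSpace t ω)]
  simp only [laplacian, gradPlus, gradMinus, Z_eq]
  ring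

theorem IsDynamicASEP.isCadlagAdapted_exp_mul (hs : IsDynamicASEP q P s) (c : ℝ)
    {f : (ℤ → ℝ) → ℝ} (hf : Continuous f) :
    IsCadlagAdapted hs.filtration fun t ω => Real.exp (c * t) * f (s t ω) :=
  (IsCadlagAdapted.of_continuous
    (by fun_prop : Continuous fun r : ℝ≥0 => Real.exp (c * r))).mul (hs.isCadlagAdapted_comp hf)

theorem IsDynamicASEP.isCadlagAdapted_Z (hq : 0 < q) (hs : IsDynamicASEP q P s) (x : ℤ) :
    IsCadlagAdapted hs.filtration fun t ω => Z q s t x ω :=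
  hs.isCadlagAdapted_exp_mul _ (continuous_sinhHeight_apply hq x)

theorem IsDynamicASEP.isCadlagAdapted_drift (hq : 0 < q) (hs : IsDynamicASEP q P s) (x : ℤ) :
    IsCadlagAdapted hs.filtration fun t ω => drift q s t x ω := by
  simp_rw [hs.drift_eq]
  exact hs.isCadlagAdapted_exp_mul _ (continuous_sinhDrift hq x)

theorem IsDynamicASEP.isCadlag_laplacian_Z (hq : 0 < q) (hs : IsDynamicASEP q P s) (x : ℤ)
    (ω : Ω) : IsCadlag fun t => laplacian (fun y => Z q s t y ω) x := by
  have h := fun y => (hs.isCadlagAdapted_Z hq y).cadlag ω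
  exact ((h (x + 1)).sub (h x)).sub
    (by simpa [gradMinus] using (h x).sub (h (x - 1)))

theorem theta1_nonneg (q : ℝ) : 0 ≤ theta1 q := sq_nonneg _

theorem abs_sinhHeight_shiftAt_le (hq : 0 < q) (hq1 : q ≤ 1) (s : ℤ → ℝ) (x y : ℤ) {h : ℝ}
    (hh : h = -2 ∨ h = 2) : |sinhHeight q (shiftAt s y h x)| ≤ coshHeight q (s x) / q :=
  (abs_sinhHeight_le hq _).trans (coshHeight_shiftAt_le hq hq1 s x y hh)

theorem abs_localGenerator_sinhHeight_le (hq : 0 < q) (hq1 : q ≤ 1) {s : ℤ → ℝ}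
    (hs : s ∈ stateSpace) (x : ℤ) :
    |localGenerator q {x} (fun s => sinhHeight q (s x)) s| ≤ 2 / q * coshHeight q (s x) := by
  refine (abs_localGenerator_le hq hq1 hs
    ((abs_sinhHeight_le hq _).trans (le_coshHeight_div hq hq1 _))
    (fun y => abs_sinhHeight_shiftAt_le hq hq1 s x y (Or.inl rfl))
    fun y => abs_sinhHeight_shiftAt_le hq hq1 s x y (Or.inr rfl)).trans (le_of_eq ?_)
  rw [Finset.card_singleton]
  push_cast
  ring

theorem abs_sinhDrift_le (hq : 0 < q) (hq1 : q ≤ 1) {s : ℤ → ℝ} (hs : s ∈ stateSpace) (x : ℤ) :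
    |sinhDrift q x s| ≤ (2 / q + theta1 q) * coshHeight q (s x) := by
  rw [add_mul]
  refine (abs_add_le _ _).trans (add_le_add (abs_localGenerator_sinhHeight_le hq hq1 hs x) ?_)
  rw [abs_mul, abs_of_nonneg (theta1_nonneg q)]
  exact mul_le_mul_of_nonneg_left (abs_sinhHeight_le hq _) (theta1_nonneg q)

theorem IsDynamicASEP.timeIntegrable_of_abs_le {f w : (ℤ → ℝ) → ℝ} (hs : IsDynamicASEP q P s)
    (hf : Continuous f) {c : ℝ} (h : ∀ s ∈ stateSpace, |f s| ≤ c * w s)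
    (hw : TimeIntegrable P fun t ω => w (s t ω)) : TimeIntegrable P fun t ω => f (s t ω) :=
  hw.mono (hs.isCadlagAdapted_comp hf) fun _ => ⟨c, fun t _ ω => h _ (hs.mem_stateSpace t ω)⟩

/-- Squares of `exp (θ₁ t) f (s t)` are integrable if `f ^ 2` is dominated by an integrable
weight. -/
theorem IsDynamicASEP.timeIntegrable_exp_mul_sq {f w : (ℤ → ℝ) → ℝ} (hs : IsDynamicASEP q P s)
    (hf : Continuous f) {c : ℝ} (h : ∀ s ∈ stateSpace, |f s| ≤ c * w s)
    (hw : TimeIntegrable P fun t ω => w (s t ω) ^ 2) :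
    TimeIntegrable P fun t ω => (Real.exp (theta1 q * t) * f (s t ω))
      * (Real.exp (theta1 q * t) * f (s t ω)) := by
  have ha := hs.isCadlagAdapted_exp_mul (theta1 q) hf
  refine hw.mono (ha.mul ha) fun T => ⟨Real.exp (theta1 q * T) ^ 2 * c ^ 2, fun t ht ω => ?_⟩
  have h1 : Real.exp (theta1 q * t) ≤ Real.exp (theta1 q * T) := by
    have := mul_le_mul_of_nonneg_left (NNReal.coe_le_coe.2 ht) (theta1_nonneg q)
    gcongr
  rw [abs_of_nonneg (mul_self_nonneg _), ← sq, mul_pow, mul_assoc, ← mul_pow c, ← sq_abs (f _)]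
  have h2 := h _ (hs.mem_stateSpace t ω)
  gcongr

variable [IsProbabilityMeasure P]

theorem integrable_coshHeight_of_integrable_Z (hq : 0 < q) (hs : IsDynamicASEP q P s) {x : ℤ}
    (hZ : Integrable (Z q s 0 x) P) : Integrable (fun ω => coshHeight q (s 0 ω x) ^ 1) P := by
  simp_rw [pow_one]
  refine (hZ.abs.add (integrable_const 2)).mono' ((hs.isCadlagAdapted_comp
    (continuous_coshHeight_apply hq x)).measurable 0).aestronglyMeasurable (ae_of_all _ fun ω => ?_)
  rw [Real.norm_of_nonneg (coshHeight_pos hq _).le]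
  simpa [Z_eq] using coshHeight_le hq (s 0 ω x)

theorem integrable_coshHeight_sq_of_memLp_Z (hq : 0 < q) {x : ℤ}
    (hZ : MemLp (Z q s 0 x) 2 P) : Integrable (fun ω => coshHeight q (s 0 ω x) ^ 2) P := by
  refine (hZ.integrable_sq.add (integrable_const 4)).congr (ae_of_all _ fun ω => ?_)
  simp [Z_eq, coshHeight_sq hq]

/-- The first moment of `coshHeight` is finite because it is at most |Z₀| + 2 initially; it
dominates Z before and after a jump up to the factor 1/q. -/
theorem IsDynamicASEP.martingale_M (hq : 0 < q) (hq1 : q ≤ 1) (hs : IsDynamicASEP q P s)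
    {x : ℤ} (hZ : Integrable (Z q s 0 x) P) : Martingale (M q s x) hs.filtration P := by
  obtain ⟨hint, htime⟩ := moment_bound hq hq1 hs x 1
    (integrable_coshHeight_of_integrable_Z hq hs hZ)
  simp_rw [pow_one] at hint htime
  have hf := continuous_sinhHeight_apply hq x
  have hN := hs.martingale_of_dominated hq hq1 (w := fun s => coshHeight q (s x) / q) hf
    (dependsOn_sinhHeight (J := {x}) (by simp))
    ((continuous_coshHeight_apply hq x).div_const q)
    (fun s => (abs_sinhHeight_le hq _).trans (le_coshHeight_div hq hq1 _))
    (fun s y => abs_sinhHeight_shiftAt_le hq hq1 s x y (Or.inl rfl))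
    (fun s y => abs_sinhHeight_shiftAt_le hq hq1 s x y (Or.inr rfl))
    (fun t => (hint t).div_const q) fun T => (htime T).div_const q
  have h := martingale_exp_mul (hs.isCadlagAdapted_comp hf)
    (hs.isCadlagAdapted_comp (continuous_localGenerator (J := {x}) hq hf))
    (hs.timeIntegrable_of_abs_le (c := 1) hf
      (fun s _ => (abs_sinhHeight_le hq _).trans (one_mul _).ge) htime)
    (hs.timeIntegrable_of_abs_le (continuous_localGenerator hq hf)
      (fun s hs => abs_localGenerator_sinhHeight_le hq hq1 hs x) htime) hN (theta1 q)
  convert h using 1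
  funext t ω
  simp only [M, primitive, hs.drift_eq, Z_eq, sinhDrift]

/-- The density of the bracket of `M(y)` and `M(x)` as a process. -/
def bracketProcess (q : ℝ) (s : ℝ≥0 → Ω → ℤ → ℝ) (y x : ℤ) (t : ℝ≥0) (ω : Ω) : ℝ :=
  Real.exp (2 * theta1 q * t) * carreDuChamp q {y, x} (fun s => sinhHeight q (s y))
    (fun s => sinhHeight q (s x)) (s t ω)

omit [IsProbabilityMeasure P] in
theorem IsDynamicASEP.isCadlagAdapted_bracketProcess (hq : 0 < q) (hs : IsDynamicASEP q P s)
    (y x : ℤ) : IsCadlagAdapted hs.filtration (bracketProcess q s y x) :=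
  hs.isCadlagAdapted_exp_mul _ (continuous_carreDuChamp hq (continuous_sinhHeight_apply hq y)
    (continuous_sinhHeight_apply hq x))

omit [IsProbabilityMeasure P] in
theorem IsDynamicASEP.bracketProcess_nonneg (hq : 0 < q) (hs : IsDynamicASEP q P s)
    (y x : ℤ) (t : ℝ≥0) (ω : Ω) : 0 ≤ bracketProcess q s y x t ω := by
  refine mul_nonneg (Real.exp_nonneg _) ?_
  rcases eq_or_ne y x with rfl | hyx
  · exact Finset.sum_nonneg fun w _ => add_nonneg
      (mul_nonneg (jumpDown_nonneg hq (hs.mem_stateSpace t ω) w) (mul_self_nonneg _))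
      (mul_nonneg (jumpUp_nonneg hq (hs.mem_stateSpace t ω) w) (mul_self_nonneg _))
  · rw [carreDuChamp_sinhHeight_of_ne _ hyx]

theorem abs_mul_le_weight {a b c d q : ℝ} (ha : |a| ≤ c / q) (hb : |b| ≤ d / q) :
    |a * b| ≤ (c ^ 2 + d ^ 2) / q ^ 2 := by
  rw [abs_mul]
  have h : (c ^ 2 + d ^ 2) / q ^ 2 = (c / q) ^ 2 + (d / q) ^ 2 := by ring
  rw [h]
  nlinarith [sq_nonneg (|a| - |b|), abs_nonneg a, abs_nonneg b,
    pow_le_pow_left₀ (abs_nonneg a) ha 2, pow_le_pow_left₀ (abs_nonneg b) hb 2]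

/-- Dynkin's formula is applied to the product of two Hopf-Cole functions, whose weight is a sum of
second moments; the drift terms are then removed by integration by parts. -/
theorem IsDynamicASEP.martingale_M_mul_M (hq : 0 < q) (hq1 : q ≤ 1) (hs : IsDynamicASEP q P s)
    (hZ : ∀ x, MemLp (Z q s 0 x) 2 P) (y x : ℤ) :
    Martingale (fun t ω => M q s y t ω * M q s x t ω
      - primitive (fun r => bracketProcess q s y x r ω) t) hs.filtration P := by
  have hmom := fun x => moment_bound hq hq1 hs x 2 (integrable_coshHeight_sq_of_memLp_Z hq (hZ x))
  have hM := fun x => hs.martingale_M hq hq1 ((hZ x).integrable one_le_two)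
  have hf := continuous_sinhHeight_apply (q := q) hq
  have hfxy : Continuous fun s : ℤ → ℝ => sinhHeight q (s y) * sinhHeight q (s x) :=
    (hf y).mul (hf x)
  set J : Finset ℤ := {y, x}
  have hyJ : y ∈ J := by simp [J]
  have hxJ : x ∈ J := by simp [J]
  set w : (ℤ → ℝ) → ℝ := fun s => (coshHeight q (s y) ^ 2 + coshHeight q (s x) ^ 2) / q ^ 2
  have hw : Continuous w := (((continuous_coshHeight_apply hq y).pow 2).add
    ((continuous_coshHeight_apply hq x).pow 2)).div_const _
  have h0 : ∀ s : ℤ → ℝ, |sinhHeight q (s y) * sinhHeight q (s x)| ≤ w s := fun s =>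
    abs_mul_le_weight ((abs_sinhHeight_le hq _).trans (le_coshHeight_div hq hq1 _))
      ((abs_sinhHeight_le hq _).trans (le_coshHeight_div hq hq1 _))
  have hshift : ∀ (s : ℤ → ℝ) (v : ℤ) (h : ℝ), h = -2 ∨ h = 2 →
      |sinhHeight q (shiftAt s v h y) * sinhHeight q (shiftAt s v h x)| ≤ w s :=
    fun s v h hh => abs_mul_le_weight (abs_sinhHeight_shiftAt_le hq hq1 s y v hh)
      (abs_sinhHeight_shiftAt_le hq hq1 s x v hh)
  have hwt : ∀ t, Integrable (fun ω => w (s t ω)) P := fun t =>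
    (((hmom y).1 t).add ((hmom x).1 t)).div_const _
  have hwi : TimeIntegrable P fun t ω => w (s t ω) := fun T =>
    (((hmom y).2 T).add ((hmom x).2 T)).div_const _
  have hJ : DependsOn (fun s : ℤ → ℝ => sinhHeight q (s y) * sinhHeight q (s x)) (J : Set ℤ) :=
    fun a b hab => by simp only [hab y (by simpa using hyJ), hab x (by simpa using hxJ)]
  have hN := hs.martingale_of_dominated hq hq1 hfxy hJ hw h0
    (fun s v => hshift s v _ (Or.inl rfl)) (fun s v => hshift s v _ (Or.inr rfl)) hwt hwi
  have hE := martingale_exp_mul (hs.isCadlagAdapted_comp hfxy)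
    (hs.isCadlagAdapted_comp (continuous_localGenerator (J := J) hq hfxy))
    (hs.timeIntegrable_of_abs_le (c := 1) hfxy (fun s _ => (h0 s).trans (one_mul _).ge) hwi)
    (hs.timeIntegrable_of_abs_le (c := J.card * 2) (continuous_localGenerator hq hfxy)
      (fun s hs => (abs_localGenerator_le hq hq1 hs (h0 s) (fun v => hshift s v _ (Or.inl rfl))
        fun v => hshift s v _ (Or.inr rfl)).trans (mul_assoc _ _ _).ge) hwi) hN (2 * theta1 q)
  have hZ2 : ∀ x, TimeIntegrable P fun t ω => Z q s t x ω * Z q s t x ω := fun x =>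
    hs.timeIntegrable_exp_mul_sq (c := 1) (hf x)
      (fun s _ => (abs_sinhHeight_le hq _).trans (one_mul _).ge) (hmom x).2
  have hD2 : ∀ x, TimeIntegrable P fun t ω => drift q s t x ω * drift q s t x ω := fun x => by
    simp_rw [hs.drift_eq]
    exact hs.timeIntegrable_exp_mul_sq (continuous_sinhDrift hq x)
      (fun s hs => abs_sinhDrift_le hq hq1 hs x) (hmom x).2
  have hZt : ∀ x t, Integrable (fun ω => Z q s t x ω * Z q s t x ω) P := fun x t => by
    have ha := hs.isCadlagAdapted_Z hq x
    refine (((hmom x).1 t).const_mul (Real.exp (theta1 q * t) ^ 2)).mono'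
      ((ha.mul ha).measurable t).aestronglyMeasurable (ae_of_all _ fun ω => ?_)
    rw [Real.norm_of_nonneg (mul_self_nonneg _), Z_eq, ← sq, mul_pow,
      ← sq_abs (sinhHeight q _)]
    have := abs_sinhHeight_le hq (s t ω x)
    gcongr
  refine martingale_mul_sub_bracket (hs.isCadlagAdapted_Z hq y) (hs.isCadlagAdapted_Z hq x)
    (hs.isCadlagAdapted_drift hq y) (hs.isCadlagAdapted_drift hq x)
    (hs.isCadlagAdapted_bracketProcess hq y x) (hZ2 y) (hZ2 x) (hD2 y) (hD2 x) (hZt y) (hZt x)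
    (hM y) (hM x) ?_
  convert hE using 1
  have hexp : ∀ t : ℝ≥0, Real.exp (2 * theta1 q * t)
      = Real.exp (theta1 q * t) * Real.exp (theta1 q * t) := fun t => by
    rw [← Real.exp_add]; ring_nf
  funext t ω
  congr 1
  · simp only [Z_eq, hexp]
    ring
  -- Up to the factor exp(2θ₁r) and with Γ the carré du champ, this is ℒ(fg) + 2θ₁fg = Γ(f,g) + f(ℒg
  -- + θ₁g) + g(ℒf + θ₁f): the rate 2θ₁ splits evenly between the two drifts.
  · congr 1
    funext r
    rw [localGenerator_mul, ← hs.localGenerator_sinhHeight_eq hyJ,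
      ← hs.localGenerator_sinhHeight_eq hxJ, hs.drift_eq, hs.drift_eq, bracketProcess, Z_eq, Z_eq,
      sinhDrift, sinhDrift, hexp]
    ring

/-- Paths of the bracket are continuous, hence predictable, and monotone because the density is
nonnegative, hence of locally bounded variation. -/
theorem IsDynamicASEP.isPredictableCovariation (hq : 0 < q) (hq1 : q ≤ 1)
    (hs : IsDynamicASEP q P s) (hZ : ∀ x, MemLp (Z q s 0 x) 2 P) (y x : ℤ) :
    IsPredictableCovariation hs.filtration P (M q s y) (M q s x)
      fun t ω => primitive (fun r => bracketProcess q s y x r ω) t where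
  predictable := isStronglyPredictable_of_continuous
    (hs.isCadlagAdapted_bracketProcess hq y x).primitive.adapted
    fun ω => ((hs.isCadlagAdapted_bracketProcess hq y x).cadlag ω).continuous_primitive
  zero ω := by simp [primitive]
  right_continuous ω := ((hs.isCadlagAdapted_bracketProcess hq y x).cadlag ω).primitive.right
  bounded_variation ω := by
    have hc := (hs.isCadlagAdapted_bracketProcess hq y x).cadlag ω
    have hmono : Monotone fun t => primitive (fun r => bracketProcess q s y x r ω) t :=
      fun a b hab => (le_abs_self _).trans (hc.abs_primitive_le
        (fun r _ => (abs_of_nonneg (hs.bracketProcess_nonneg hq y x r ω)).le) hab)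
    exact (hmono.monotoneOn _).locallyBoundedVariationOn
  martingale := hs.martingale_M_mul_M hq hq1 hZ y x

end HopfCole

end DynASEP

end

/-! ### Assembly of the proposition. -/

open DynASEP in
theorem proposition2p1 :
    ∃ C : ℝ, ∀ (ε : ℝ), 0 < ε → ∀ (q : ℝ), q = Real.exp (-ε) →
      ∀ {Ω : Type*} [MeasurableSpace Ω] (P : Measure Ω) [IsProbabilityMeasure P]
        (s : ℝ≥0 → Ω → ℤ → ℝ) (hs : IsDynamicASEP q P s),
      -- the time integrals below are genuine integrals
      (∀ x (t : ℝ≥0) ω,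
        IntervalIntegrable (fun r : ℝ => drift q s r.toNNReal x ω) volume 0 t ∧
        IntervalIntegrable (fun r : ℝ => laplacian (fun y => Z q s r.toNNReal y ω) x)
          volume 0 t) ∧
      -- the microscopic stochastic heat equation, in integrated form
      (∀ x (t : ℝ≥0) ω,
        Z q s t x ω = Z q s 0 x ω
          + (∫ r in (0 : ℝ)..t, theta2 q / 2 * laplacian (fun y => Z q s r.toNNReal y ω) x)
          + (M q s x t ω - M q s x 0 ω)) ∧
      -- the martingale property
      ((∀ x, Integrable (Z q s 0 x) P) → ∀ x, Martingale (M q s x) hs.filtration P) ∧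
      -- the predictable brackets
      ((∀ x, MemLp (Z q s 0 x) 2 P) →
        ∃ (𝓔 : ℝ≥0 → ℤ → Ω → ℝ) (br : ℤ → ℤ → ℝ≥0 → Ω → ℝ),
          (∀ t x ω, |𝓔 t x ω| ≤ C * ε) ∧
          (∀ y x, IsPredictableCovariation hs.filtration P (M q s y) (M q s x) (br y x)) ∧
          (∀ y x (t : ℝ≥0) ω,
            IntervalIntegrable (fun r : ℝ =>
              bracketDensity ε r y x (s r.toNNReal ω) (𝓔 r.toNNReal x ω)) volume 0 t ∧
            br y x t ω = ∫ r in (0 : ℝ)..t,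
              bracketDensity ε r y x (s r.toNNReal ω) (𝓔 r.toNNReal x ω)) ∧
          (∀ y x (t : ℝ≥0) ω,
            HasDerivWithinAt (fun r : ℝ => br y x r.toNNReal ω)
              (bracketDensity ε t y x (s t ω) (𝓔 t x ω)) (Set.Ici (t : ℝ)) t) ∧
          (ε ≤ 1 → ∀ x (t : ℝ≥0) ω,
            derivWithin (fun r : ℝ => br x x r.toNNReal ω) (Set.Ici (t : ℝ)) t
              ≤ 2 * ε ^ 2 * (Z q s t x ω ^ 2 + 2 * Real.exp (2 * t * theta1 q)))) := by
  refine ⟨6, fun ε hε q hqε Ω _ P _ s hs => ?_⟩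
  have hq : 0 < q := hqε ▸ Real.exp_pos _
  have hq1 : q ≤ 1 := hqε ▸ Real.exp_le_one_iff.2 (by linarith)
  refine ⟨fun x t ω => ⟨((hs.isCadlagAdapted_drift hq x).cadlag ω).intervalIntegrable _ _,
    (hs.isCadlag_laplacian_Z hq x ω).intervalIntegrable _ _⟩, fun x t ω => ?_,
    fun hZ x => hs.martingale_M hq hq1 (hZ x), fun hZ => ?_⟩
  · simp only [M, ← hs.drift_eq_laplacian hq, NNReal.coe_zero, intervalIntegral.integral_same]
    ring
  have hdens : ∀ (y x : ℤ) (r : ℝ≥0) ω, bracketProcess q s y x r ω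
      = bracketDensity ε r y x (s r ω) (errorTerm ε (s r ω) x) := fun y x r ω => by
    subst hqε
    exact exp_mul_carreDuChamp_eq_bracketDensity hε (hs.mem_stateSpace r ω) r x y {y, x}
      (by rintro rfl; simp)
  have hcad := fun y x ω => (hs.isCadlagAdapted_bracketProcess hq y x).cadlag ω
  -- The density carries the real time r and the process its truncation to r ≥ 0, so the two are
  -- compared on nonnegative times only.
  have hEq : ∀ (y x : ℤ) (t : ℝ≥0) ω, Set.EqOn
      (fun r : ℝ => bracketProcess q s y x r.toNNReal ω)
      (fun r : ℝ => bracketDensity ε r y x (s r.toNNReal ω) (errorTerm ε (s r.toNNReal ω) x))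
      (Set.uIcc (0 : ℝ) t) := fun y x t ω r hr => by
    rw [Set.uIcc_of_le (NNReal.coe_nonneg t)] at hr
    simp only [hdens, Real.coe_toNNReal r hr.1]
  have hderiv : ∀ (y x : ℤ) (t : ℝ≥0) ω, HasDerivWithinAt
      (fun r : ℝ => primitive (fun r => bracketProcess q s y x r ω) r.toNNReal)
      (bracketProcess q s y x t ω) (Set.Ici (t : ℝ)) t := fun y x t ω => by
    have h := (hcad y x ω).hasDerivWithinAt_primitive t
    rw [Real.toNNReal_coe] at h
    refine h.congr (fun r hr => ?_) ?_
    · rw [primitive, Real.coe_toNNReal r (t.2.trans hr)]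
    · rw [primitive, Real.toNNReal_coe]
  refine ⟨fun t x ω => errorTerm ε (s t ω) x,
    fun y x t ω => primitive (fun r => bracketProcess q s y x r ω) t,
    fun t x ω => abs_errorTerm_le hε (hs.mem_stateSpace t ω) x,
    fun y x => hs.isPredictableCovariation hq hq1 hZ y x, fun y x t ω => ⟨?_, ?_⟩,
    fun y x t ω => ?_, fun hε1 x t ω => ?_⟩
  · exact ((hcad y x ω).intervalIntegrable 0 t).congr
      fun r hr => hEq y x t ω (Set.uIoc_subset_uIcc hr)
  · exact intervalIntegral.integral_congr (hEq y x t ω)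
  · rw [← hdens]
    exact hderiv y x t ω
  · rw [(hderiv x x t ω).derivWithin (uniqueDiffOn_Ici _ _ Set.self_mem_Ici), bracketProcess,
      Finset.pair_eq_singleton, Z_eq]
    have h := carreDuChamp_sinhHeight_le hε hε1 (hs.mem_stateSpace t ω) x
    rw [← hqε] at h
    have hexp : Real.exp (2 * t * theta1 q) = Real.exp (theta1 q * t) ^ 2 := by
      rw [← Real.exp_nat_mul]; congr 1; push_cast; ring
    rw [show 2 * theta1 q * t = 2 * t * theta1 q by ring, hexp]
    nlinarith [mul_le_mul_of_nonneg_left h (sq_nonneg (Real.exp (theta1 q * t)))]
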